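/- Let $K$ be a field of characteristic $0$ and let $\chi\colon L\to M$ be a morphism of differential graded Lie algebras over $K$. Regard $\chi$ as the semicosimplicial DGLA $\chi^{\Delta}\colon L\rightrightarrows M\to 0\cdots$ with coface maps $\partial_0=\chi$, $\partial_1=0$. Its total complex is the mapping cone $$\operatorname{Tot}(\chi^\Delta)^i=L^i\oplus M^{i-1},\qquad d(l,m)=(dl,\chi(l)-dm),$$ and its Thom–Whitney DGLA is $$\operatorname{Tot}_{TW}(\chi^\Delta)=\{(l,\,P(t)+dt\,Q(t))\in L\times M[t,dt] \;:\; P(0)=0,\ P(1)=\chi(l)\},$$ with the differential and the bracket induced by those of $L$, $M$ and $K[t,dt]$. The maps $$I(l,P+dt\,Q)=\Big(l,\int_0^1Q\,dt\Big),\qquad E(l,m)=(l,\,t\chi(l)+dt\,m),\qquad h(l,P+dt\,Q)=\Big(0,\ \int_0^tQ\,ds-t\int_0^1Q\,ds\Big)$$ are such that $I$ and $E$ are morphisms of complexes and $hq_1+q_1h=EI-\mathrm{Id}$, where $q_1=-d$ and $q_2(x\odot y)=(-1)^{\deg x}[x,y]$ are the $L_\infty$ operations of the DGLA $\operatorname{Tot}_{TW}(\chi^\Delta)$,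 on $\operatorname{Tot}_{TW}(\chi^\Delta)[1]$. Homotopy transfer along $I,E,h$ defines the canonical brackets $\langle\,\rangle_n\in\operatorname{Hom}^1(\bigodot^n \operatorname{Tot}(\chi^\Delta)[1],\operatorname{Tot}(\chi^\Delta)[1])$: with $E_1=E$ and $\langle v\rangle_1=-dv$, for $n\ge2$ and homogeneous $v_1,\dots,v_n$, $$E_n(v_1,\dots,v_n)=\tfrac12\sum_{S}\varepsilon(S)\,h\,q_2\big(E_{|S|}(v_S)\odot E_{n-|S|}(v_{S^c})\big),\qquad \langle v_1,\dots,v_n\rangle_n=\tfrac12\sum_{S}\varepsilon(S)\,I\,q_2\big(E_{|S|}(v_S)\odot E_{n-|S|}(v_{S^c})\big),$$ where $S$ runs over the nonempty proper subsets of $\{1,\dots,n\}$, $v_S$ is the subsequence with indices in $S$, and $\varepsilon(S)$ is the Koszul sign (for the degrees in $\operatorname{Tot}(\chi^\Delta)[1]$) of the unshuffle that lists $S$ before $S^c$. Write $\widetilde{\operatorname{Tot}}(\chi^\Delta)$ for the graded vector space $\operatorname{Tot}(\chi^\Delta)$ with these brackets. An $L_\infty$-algebra is called abelian if all its brackets of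 arity $n\ge 2$ vanish, and quasi-abelian if it is equivalent to an abelian one under the equivalence relation generated by the existence of a quasi-isomorphism, i.e. of an $L_\infty$-morphism whose linear part induces an isomorphism in cohomology. **Proposition.** Assume that 1. $\chi\colon L\to M$ is injective, and 2. $\chi\colon H^*(L)\to H^*(M)$ is injective. Then $\widetilde{\operatorname{Tot}}(\chi^\Delta)$ is an $L_\infty$-algebra, and it is quasi-abelian. -/

import Mathlib

open scoped TensorProduct

universe u w v

/-! ## Graded vector spaces -/

/-- A `ℤ`-graded vector space `V = ⊕ᵢ Vⁱ` over `K`. -/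
structure GradedSpace (K : Type v) [Field K] where
  carrier : Type u
  [addCommGroup : AddCommGroup carrier]
  [module : Module K carrier]
  /-- `deg i` is the homogeneous part `Vⁱ` -/
  deg : ℤ → Submodule K carrier
  internal : DirectSum.IsInternal deg

attribute [instance] GradedSpace.addCommGroup GradedSpace.module

namespace GradedSpace

variable {K : Type v} [Field K]

instance : CoeSort (GradedSpace.{u} K) (Type u) := ⟨GradedSpace.carrier⟩

/-- The linear map `V → N` with prescribed restrictions to the homogeneous parts of `V`. -/
noncomputable def lift (V : GradedSpace.{u} K) {N : Type w} [AddCommGroup N] [Module K N]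
    (φ : ∀ i, V.deg i →ₗ[K] N) : V →ₗ[K] N :=
  DirectSum.toModule K ℤ N φ ∘ₗ
    (LinearEquiv.ofBijective (DirectSum.coeLinearMap V.deg) V.internal).symm.toLinearMap

theorem lift_of_mem (V : GradedSpace.{u} K) {N : Type w} [AddCommGroup N] [Module K N]
    (φ : ∀ i, V.deg i →ₗ[K] N) {i : ℤ} {x : V} (hx : x ∈ V.deg i) :
    V.lift φ x = φ i ⟨x, hx⟩ := by
  have h : (LinearEquiv.ofBijective (DirectSum.coeLinearMap V.deg) V.internal).symm x
      = DirectSum.lof K ℤ (fun i => V.deg i) i ⟨x, hx⟩ := by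
    rw [LinearEquiv.symm_apply_eq]
    exact (DirectSum.coeLinearMap_lof V.deg i ⟨x, hx⟩).symm
  simp only [lift, LinearMap.comp_apply, LinearEquiv.coe_coe]
  rw [h, DirectSum.toModule_lof]

/-- The projection of `V` onto `Vⁱ`. -/
noncomputable def proj (V : GradedSpace.{u} K) (i : ℤ) : V →ₗ[K] V :=
  V.lift fun j => if j = i then (V.deg j).subtype else 0

/-- The linear involution `v ↦ (-1)^{deg v} v`. -/
noncomputable def sgn (V : GradedSpace.{u} K) : V →ₗ[K] V :=
  V.lift fun j => j.negOnePow • (V.deg j).subtype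

/-- The projection of `V` onto its even part (`a = 0`) or its odd part (`a = 1`). -/
noncomputable def parityPart (V : GradedSpace.{u} K) (a : Fin 2) : V →ₗ[K] V :=
  V.lift fun j => if j % 2 = (a : ℤ) then (V.deg j).subtype else 0

theorem proj_of_mem (V : GradedSpace.{u} K) {i : ℤ} {x : V} (hx : x ∈ V.deg i) :
    V.proj i x = x := by
  simp [proj, V.lift_of_mem _ hx]

theorem proj_of_mem_ne (V : GradedSpace.{u} K) {i j : ℤ} {x : V} (hx : x ∈ V.deg j)
    (h : j ≠ i) : V.proj i x = 0 := by
  simp [proj, V.lift_of_mem _ hx, h]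

theorem sgn_of_mem (V : GradedSpace.{u} K) {i : ℤ} {x : V} (hx : x ∈ V.deg i) :
    V.sgn x = i.negOnePow • x := by
  rw [sgn, V.lift_of_mem _ hx]; rfl

theorem parityPart_of_mem (V : GradedSpace.{u} K) {i : ℤ} {x : V} (hx : x ∈ V.deg i)
    (a : Fin 2) : V.parityPart a x = if i % 2 = (a : ℤ) then x else 0 := by
  rw [parityPart, V.lift_of_mem _ hx]; split_ifs <;> rfl

theorem induction (V : GradedSpace.{u} K) {p : V → Prop} (x : V)
    (hom : ∀ i, ∀ y ∈ V.deg i, p y) (zero : p 0) (add : ∀ y z, p y → p z → p (y + z)) : p x := by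
  have hx : x ∈ iSup V.deg := by rw [V.internal.submodule_iSup_eq_top]; trivial
  induction hx using Submodule.iSup_induction' with
  | mem i y hy => exact hom i y hy
  | zero => exact zero
  | add y z _ _ h1 h2 => exact add y z h1 h2

theorem proj_mem (V : GradedSpace.{u} K) (i : ℤ) (x : V) : V.proj i x ∈ V.deg i := by
  refine V.induction (p := fun x => V.proj i x ∈ V.deg i) x ?_ ?_ ?_
  · intro j y hy
    by_cases h : j = i
    · subst h; rwa [V.proj_of_mem hy]
    · rw [V.proj_of_mem_ne hy h]; exact zero_mem _
  · simp
  · intro y z hy hz; rw [map_add]; exact add_mem hy hz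

/-- Every vector is the sum of its homogeneous components. -/
theorem exists_sum_proj (V : GradedSpace.{u} K) (x : V) :
    ∃ S : Finset ℤ, ∀ T : Finset ℤ, S ⊆ T → ∑ i ∈ T, V.proj i x = x := by
  refine V.induction
    (p := fun x => ∃ S : Finset ℤ, ∀ T : Finset ℤ, S ⊆ T → ∑ i ∈ T, V.proj i x = x) x ?_ ?_ ?_
  · intro i y hy
    refine ⟨{i}, fun T hT => ?_⟩
    rw [Finset.sum_eq_single_of_mem i (hT (by simp)), V.proj_of_mem hy]
    intro j _ hj; exact V.proj_of_mem_ne hy (Ne.symm hj)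
  · exact ⟨∅, fun T _ => by simp⟩
  · rintro y z ⟨S, hS⟩ ⟨S', hS'⟩
    refine ⟨S ∪ S', fun T hT => ?_⟩
    simp only [map_add, Finset.sum_add_distrib]
    rw [hS T (Finset.union_subset_left hT), hS' T (Finset.union_subset_right hT)]

theorem exists_sum_proj_shift (V : GradedSpace.{u} K) (n : ℤ) (x : V) :
    ∃ S : Finset ℤ, ∀ T : Finset ℤ, S ⊆ T → ∑ i ∈ T, V.proj (n + i) x = x := by
  obtain ⟨S, hS⟩ := V.exists_sum_proj x
  refine ⟨S.map (Equiv.addLeft (-n)).toEmbedding, fun T hT => ?_⟩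
  have h : S ⊆ T.map (Equiv.addLeft n).toEmbedding := by
    intro j hj
    rw [Finset.mem_map]
    refine ⟨-n + j, hT (Finset.mem_map_of_mem _ hj), ?_⟩
    simp
  have e := hS _ h
  rw [Finset.sum_map] at e
  exact e

/-- A criterion for a family of subspaces to be a grading. -/
theorem isInternal_of_proj {N : Type w} [AddCommGroup N] [Module K N] (D : ℤ → Submodule K N)
    (p : ℤ → N →ₗ[K] N) (hmem : ∀ i x, p i x ∈ D i) (hid : ∀ i, ∀ x ∈ D i, p i x = x)
    (hne : ∀ i j, j ≠ i → ∀ x ∈ D j, p i x = 0)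
    (hsum : ∀ x, ∃ T : Finset ℤ, ∑ i ∈ T, p i x = x) : DirectSum.IsInternal D := by
  apply DirectSum.isInternal_submodule_of_iSupIndep_of_iSup_eq_top
  · intro i
    rw [Submodule.disjoint_def]
    intro x hx hx'
    have h0 : (⨆ j, ⨆ (_ : j ≠ i), D j) ≤ LinearMap.ker (p i) :=
      iSup_le fun j => iSup_le fun hj => fun y hy => hne i j hj y hy
    rw [← hid i x hx]; exact h0 hx'
  · rw [eq_top_iff]
    intro x _
    obtain ⟨T, hT⟩ := hsum x
    rw [← hT]
    exact Submodule.sum_mem _ fun i _ => Submodule.mem_iSup_of_mem i (hmem i x)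

/-- The shift `V[n]`, with `V[n]ⁱ = Vⁿ⁺ⁱ`. -/
abbrev shift (V : GradedSpace.{u} K) (n : ℤ) : GradedSpace.{u} K where
  carrier := V
  deg i := V.deg (n + i)
  internal := by
    refine isInternal_of_proj _ (fun i => V.proj (n + i)) (fun i x => V.proj_mem _ x)
      (fun i x hx => V.proj_of_mem hx) (fun i j h x hx => V.proj_of_mem_ne hx (by simpa using h))
      fun x => ?_
    obtain ⟨S, hS⟩ := V.exists_sum_proj_shift n x
    exact ⟨S, hS S (subset_refl _)⟩

/-- The product `V × W[n]`, whose part of degree `i` is `Vⁱ × Wⁿ⁺ⁱ`. -/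
abbrev prodShift (V W : GradedSpace.{u} K) (n : ℤ) : GradedSpace.{u} K where
  carrier := V × W
  deg i := (V.deg i).prod (W.deg (n + i))
  internal := by
    refine isInternal_of_proj _ (fun i => (V.proj i).prodMap (W.proj (n + i)))
      (fun i x => ⟨V.proj_mem _ _, W.proj_mem _ _⟩)
      (fun i x hx => Prod.ext (V.proj_of_mem hx.1) (W.proj_of_mem hx.2))
      (fun i j h x hx => Prod.ext (V.proj_of_mem_ne hx.1 h)
        (W.proj_of_mem_ne hx.2 (by simpa using h)))
      fun x => ?_
    obtain ⟨S, hS⟩ := V.exists_sum_proj x.1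
    obtain ⟨S', hS'⟩ := W.exists_sum_proj_shift n x.2
    refine ⟨S ∪ S', Prod.ext ?_ ?_⟩
    · rw [Prod.fst_sum]; exact hS _ Finset.subset_union_left
    · rw [Prod.snd_sum]; exact hS' _ Finset.subset_union_right

end GradedSpace

/-! ## Complexes and cohomology -/

/-- A differential graded vector space. -/
structure DGSpace (K : Type v) [Field K] extends GradedSpace.{u} K where
  d : carrier →ₗ[K] carrier
  d_mem : ∀ i, ∀ x ∈ deg i, d x ∈ deg (i + 1)
  d_d : ∀ x, d (d x) = 0

/-- The cohomology `ker d / im d` of an endomorphism `d` (used for `d² = 0`). -/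
abbrev Cohomology {K : Type v} [Field K] {V : Type u} [AddCommGroup V] [Module K V]
    (d : V →ₗ[K] V) : Type u :=
  LinearMap.ker d ⧸ (LinearMap.range d).submoduleOf (LinearMap.ker d)

/-- The map induced in cohomology by a linear map that commutes with the differentials. -/
def Cohomology.map {K : Type v} [Field K] {V : Type u} [AddCommGroup V] [Module K V]
    {W : Type w} [AddCommGroup W] [Module K W] {d : V →ₗ[K] V} {d' : W →ₗ[K] W}
    (f : V →ₗ[K] W) (hf : ∀ x, f (d x) = d' (f x)) : Cohomology d →ₗ[K] Cohomology d' :=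
  Submodule.mapQ _ _
    (f.restrict (p := LinearMap.ker d) (q := LinearMap.ker d') fun x hx => by
      rw [LinearMap.mem_ker] at hx ⊢; rw [← hf, hx, map_zero])
    (by
      rintro ⟨x, hx⟩ ⟨y, hy⟩
      exact ⟨f y, by rw [← hf, hy]; rfl⟩)

/-! ## Differential graded Lie algebras -/

/-- A differential graded Lie algebra. -/
structure DGLA (K : Type v) [Field K] extends DGSpace.{u} K where
  br : carrier →ₗ[K] carrier →ₗ[K] carrier
  br_mem : ∀ i j, ∀ x ∈ deg i, ∀ y ∈ deg j, br x y ∈ deg (i + j)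
  skew : ∀ i j, ∀ x ∈ deg i, ∀ y ∈ deg j, br x y = -((i * j).negOnePow • br y x)
  jacobi : ∀ i j k, ∀ x ∈ deg i, ∀ y ∈ deg j, ∀ z ∈ deg k,
    br x (br y z) = br (br x y) z + (i * j).negOnePow • br y (br x z)
  leibniz : ∀ i j, ∀ x ∈ deg i, ∀ y ∈ deg j,
    d (br x y) = br (d x) y + i.negOnePow • br x (d y)

/-- A morphism of DGLAs. -/
structure DGLAHom {K : Type v} [Field K] (L : DGLA.{u} K) (M : DGLA.{w} K) where
  toLinearMap : L.carrier →ₗ[K] M.carrier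
  map_mem : ∀ i, ∀ x ∈ L.deg i, toLinearMap x ∈ M.deg i
  map_d : ∀ x, toLinearMap (L.d x) = M.d (toLinearMap x)
  map_br : ∀ x y, toLinearMap (L.br x y) = M.br (toLinearMap x) (toLinearMap y)

namespace DGLA

variable {K : Type v} [Field K]

/-- The linear part `q₁ = -d` of the `L∞` structure of a DGLA. -/
def q₁ (A : DGLA.{u} K) : A.carrier →ₗ[K] A.carrier := -A.d

/-- The quadratic part `q₂(x ⊙ y) = (-1)^{deg x} [x, y]` of the `L∞` structure of a DGLA. -/
noncomputable def q₂ (A : DGLA.{u} K) : A.carrier →ₗ[K] A.carrier →ₗ[K] A.carrier :=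
  A.br ∘ₗ A.sgn

end DGLA

/-! ## `L∞`-algebras -/

/-- Let `v₁, …, vₙ` have degrees `deg 1, …, deg n` and let colours `c 1, …, c n` in a linear order
be given. This is the sign obtained by the Koszul rule when `v₁ ⊙ ⋯ ⊙ vₙ` is rearranged by
increasing colours, elements with the same colour being kept in their order. -/
def koszulSign {n : ℕ} {α : Type*} [LinearOrder α] (deg : Fin n → ℤ) (c : Fin n → α) : ℤˣ :=
  ∏ i : Fin n, ∏ j : Fin n, if i < j ∧ c j < c i then (deg i * deg j).negOnePow else 1

/-- The colouring with colour `0` on `A` and colour `1` outside `A`. Rearranging by increasing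
colours is the unshuffle which lists `A` first, and then its complement. -/
def unshuffle {n : ℕ} (A : Finset (Fin n)) (i : Fin n) : Fin 2 := if i ∈ A then 0 else 1

/-- The subsequence of `v₁, …, vₙ` with indices in `A`. -/
def subTuple {n : ℕ} {V : Type*} (v : Fin n → V) (A : Finset (Fin n)) : Fin A.card → V :=
  fun k => v (A.orderEmbOfFin rfl k)

/-- `v₁, …, vₙ` are homogeneous of degrees `deg 1, …, deg n`. -/
def IsHomogeneousTuple {K : Type v} [Field K] (U : GradedSpace.{u} K) {n : ℕ} (deg : Fin n → ℤ)
    (v : Fin n → U) : Prop :=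
  ∀ i, v i ∈ U.deg (deg i)

/-- The multilinear map `g` is an element of `Hom^e(⊙ⁿ U, W)`: it has degree `e` and is
symmetric in the graded sense,
`g(v₁, …, vₙ) = ε(σ; v₁, …, vₙ) g(v_{σ(1)}, …, v_{σ(n)})`. -/
structure IsSymHom {K : Type v} [Field K] (U : GradedSpace.{u} K) (W : GradedSpace.{w} K) (e : ℤ)
    {n : ℕ} (g : MultilinearMap K (fun _ : Fin n => U.carrier) W.carrier) : Prop where
  map_mem : ∀ (deg : Fin n → ℤ) (v : Fin n → U), IsHomogeneousTuple U deg v →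
    g v ∈ W.deg ((∑ i, deg i) + e)
  symm : ∀ (deg : Fin n → ℤ) (v : Fin n → U), IsHomogeneousTuple U deg v →
    ∀ σ : Equiv.Perm (Fin n), g v = koszulSign deg (⇑σ.symm) • g (v ∘ σ)

/-- The maps `qₙ ∈ Hom¹(⊙ⁿ V[1], V[1])`, `n ≥ 1`, form an `L∞` structure on `V`: the coderivation
`Q` which they determine on the reduced symmetric coalgebra of `V[1]` satisfies `QQ = 0`, that is,
`∑_{k, σ ∈ S(k, n-k)} ε(σ) q_{n-k+1}(q_k(v_{σ(1)}, …, v_{σ(k)}), v_{σ(k+1)}, …, v_{σ(n)}) = 0`.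
An unshuffle `σ ∈ S(k, n-k)` is given by the set `A = {σ(1), …, σ(k)}`. There is no `q₀`; the
corresponding entry of the sequence is set to `0`. -/
structure IsLInfinity {K : Type v} [Field K] (V : GradedSpace.{u} K)
    (q : ∀ n : ℕ, MultilinearMap K (fun _ : Fin n => V.carrier) V.carrier) : Prop where
  zero : q 0 = 0
  isSymHom : ∀ n, IsSymHom (V.shift 1) (V.shift 1) 1 (q n)
  jacobi : ∀ (n : ℕ) (deg : Fin n → ℤ) (v : Fin n → V),
    IsHomogeneousTuple (V.shift 1) deg v →
    ∑ A : Finset (Fin n) with A.Nonempty, koszulSign deg (unshuffle A) •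
      q (Aᶜ.card + 1) (Fin.cons (q A.card (subTuple v A)) (subTuple v Aᶜ)) = 0

/-- An `L∞`-algebra `(V, q₁, q₂, …)`. -/
structure LInfinityAlgebra (K : Type v) [Field K] where
  space : GradedSpace.{u} K
  q : ∀ n : ℕ, MultilinearMap K (fun _ : Fin n => space.carrier) space.carrier
  isLInfinity : IsLInfinity space q

namespace LInfinityAlgebra

variable {K : Type v} [Field K]

/-- An `L∞`-algebra is abelian if `qₙ = 0` for all `n ≥ 2`. -/
def IsAbelian (V : LInfinityAlgebra.{u} K) : Prop := ∀ n, 2 ≤ n → V.q n = 0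

/-- The differential `q₁` of `V[1]`. -/
def differential (V : LInfinityAlgebra.{u} K) : V.space →ₗ[K] V.space :=
  (MultilinearMap.ofSubsingleton K V.space.carrier V.space.carrier (0 : Fin 1)).symm (V.q 1)

/-- An `L∞`-morphism `V → W`: maps `fₙ ∈ Hom⁰(⊙ⁿ V[1], W[1])`, `n ≥ 1`, such that the morphism of
coalgebras `F` which they determine commutes with the codifferentials. In terms of corestrictions
this is
`∑_{k, σ ∈ S(k, n-k)} ε(σ) f_{n-k+1}(q_k(v_{σ(1)}, …, v_{σ(k)}), v_{σ(k+1)}, …, v_{σ(n)})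
  = ∑_r (1 / r!) ∑_{(B₁, …, B_r)} ε(B₁, …, B_r) p_r(f(v_{B₁}), …, f(v_{B_r}))`,
the inner sum being over the ordered partitions of `{1, …, n}` into `r` nonempty blocks, written
as surjections `c : {1, …, n} → {1, …, r}`. -/
structure Morphism (V W : LInfinityAlgebra.{u} K) where
  f : ∀ n : ℕ, MultilinearMap K (fun _ : Fin n => V.space.carrier) W.space.carrier
  zero : f 0 = 0
  isSymHom : ∀ n, IsSymHom (V.space.shift 1) (W.space.shift 1) 0 (f n)
  comm : ∀ (n : ℕ) (deg : Fin n → ℤ) (v : Fin n → V.space),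
    IsHomogeneousTuple (V.space.shift 1) deg v →
    ∑ A : Finset (Fin n) with A.Nonempty, koszulSign deg (unshuffle A) •
      f (Aᶜ.card + 1) (Fin.cons (V.q A.card (subTuple v A)) (subTuple v Aᶜ)) =
    ∑ r ∈ Finset.range (n + 1), ((r.factorial : K)⁻¹) •
      ∑ c : Fin n → Fin r with Function.Surjective c, koszulSign deg c •
        W.q r fun k => f (Finset.card {i | c i = k}) (subTuple v {i | c i = k})

/-- The linear part `f₁` of an `L∞`-morphism. -/
def Morphism.linearPart {V W : LInfinityAlgebra.{u} K} (F : Morphism V W) :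
    V.space →ₗ[K] W.space :=
  (MultilinearMap.ofSubsingleton K V.space.carrier W.space.carrier (0 : Fin 1)).symm (F.f 1)

/-- A quasi-isomorphism is an `L∞`-morphism whose linear part is a quasi-isomorphism of
complexes. -/
def Morphism.IsQuasiIso {V W : LInfinityAlgebra.{u} K} (F : Morphism V W) : Prop :=
  ∃ h : ∀ x, F.linearPart (V.differential x) = W.differential (F.linearPart x),
    Function.Bijective (Cohomology.map F.linearPart h)

/-- Two `L∞`-algebras are quasi-isomorphic if they are equivalent under the equivalence relation
generated by the existence of a quasi-isomorphism. -/
def QuasiIsomorphic (V W : LInfinityAlgebra.{u} K) : Prop :=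
  Relation.EqvGen (fun V W : LInfinityAlgebra.{u} K => ∃ F : Morphism V W, F.IsQuasiIso) V W

/-- An `L∞`-algebra is quasi-abelian if it is quasi-isomorphic to an abelian one. -/
def IsQuasiAbelian (V : LInfinityAlgebra.{u} K) : Prop :=
  ∃ W : LInfinityAlgebra.{u} K, W.IsAbelian ∧ QuasiIsomorphic V W

end LInfinityAlgebra

/-! ## Homotopy transfer -/

/-- The data for homotopy transfer from a DGLA `A` to a complex `C`: morphisms of complexes
`π : A → C` and `ι : C → A`, and a linear map `h` of degree `-1` with
`h q₁ + q₁ h = ι π - Id`, where `q₁ = -d` is the differential of `A[1]`. -/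
structure TransferData {K : Type v} [Field K] (A : DGLA.{w} K) (C : DGSpace.{u} K) where
  π : A.carrier →ₗ[K] C.carrier
  ι : C.carrier →ₗ[K] A.carrier
  h : A.carrier →ₗ[K] A.carrier
  π_mem : ∀ i, ∀ x ∈ A.deg i, π x ∈ C.deg i
  ι_mem : ∀ i, ∀ x ∈ C.deg i, ι x ∈ A.deg i
  h_mem : ∀ i, ∀ x ∈ A.deg i, h x ∈ A.deg (i - 1)
  π_d : ∀ x, π (A.d x) = C.d (π x)
  ι_d : ∀ x, ι (C.d x) = A.d (ι x)
  homotopy : ∀ x, h (A.q₁ x) + A.q₁ (h x) = ι (π x) - x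

namespace TransferData

variable {K : Type v} [Field K] {A : DGLA.{w} K} {C : DGSpace.{u} K}

/-- The multilinear extension of `(v₁, …, vₙ) ↦ ε(σ; v₁, …, vₙ) g(v₁, …, vₙ)`, where `σ` is the
unshuffle of the homogeneous elements `v₁, …, vₙ` of `U` which lists the indices in `S` first. The
sign depends only on the parities of the degrees. -/
noncomputable def withSign (U : GradedSpace.{u} K) {n : ℕ} (S : Finset (Fin n)) {N : Type w}
    [AddCommGroup N] [Module K N] (g : MultilinearMap K (fun _ : Fin n => U.carrier) N) :
    MultilinearMap K (fun _ : Fin n => U.carrier) N :=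
  ∑ p : Fin n → Fin 2, koszulSign (fun i => ((p i : ℕ) : ℤ)) (unshuffle S) •
    g.compLinearMap fun i => U.parityPart (p i)

/-- The multilinear map `(v₁, …, vₙ) ↦ β (a (v_S), b (v_{Sᶜ}))`. -/
noncomputable def pair {U : Type u} [AddCommGroup U] [Module K U] {N : Type w} [AddCommGroup N]
    [Module K N] (β : N →ₗ[K] N →ₗ[K] N) {n : ℕ} (S : Finset (Fin n))
    (a : MultilinearMap K (fun _ : Fin S.card => U) N)
    (b : MultilinearMap K (fun _ : Fin Sᶜ.card => U) N) :
    MultilinearMap K (fun _ : Fin n => U) N :=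
  ((TensorProduct.lift β).compMultilinearMap (a.domCoprod b)).domDomCongr
    (finSumEquivOfFinset rfl rfl)

/-- The components `ιₙ` of the `L∞`-morphism `ι_∞` extending `ι`: `ι₁ = ι` and, for `n ≥ 2`,
`ιₙ(v₁, …, vₙ) = ½ ∑_S ε h q₂(ι(v_S), ι(v_{Sᶜ}))`, the sum being over all nonempty proper subsets
`S` of `{1, …, n}` (so every unordered partition into two blocks is counted twice). -/
noncomputable def ιInfty (T : TransferData A C) :
    (n : ℕ) → MultilinearMap K (fun _ : Fin n => C.carrier) A.carrier
  | 0 => 0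
  | 1 => MultilinearMap.ofSubsingleton K C.carrier A.carrier (0 : Fin 1) T.ι
  | n + 2 => T.h.compMultilinearMap ((2⁻¹ : K) •
      ∑ S : {S : Finset (Fin (n + 2)) // S.Nonempty ∧ Sᶜ.Nonempty},
        withSign (C.shift 1) S.1 (pair A.q₂ S.1 (T.ιInfty S.1.card) (T.ιInfty S.1ᶜ.card)))
termination_by n => n
decreasing_by
  all_goals
    have h := Finset.card_add_card_compl S.1
    have h1 := S.2.1.card_pos
    have h2 := S.2.2.card_pos
    rw [Fintype.card_fin] at h
    omega

/-- The transferred brackets on `C`: the first one is the differential `-d` of `C[1]`, and for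
`n ≥ 2`,
`⟨v₁, …, vₙ⟩ = ½ ∑_S ε π q₂(ι_∞(v_S), ι_∞(v_{Sᶜ}))`, the sum being over all nonempty proper subsets
`S` of `{1, …, n}`. -/
noncomputable def bracket (T : TransferData A C) :
    (n : ℕ) → MultilinearMap K (fun _ : Fin n => C.carrier) C.carrier
  | 0 => 0
  | 1 => MultilinearMap.ofSubsingleton K C.carrier C.carrier (0 : Fin 1) (-C.d)
  | n + 2 => T.π.compMultilinearMap ((2⁻¹ : K) •
      ∑ S : {S : Finset (Fin (n + 2)) // S.Nonempty ∧ Sᶜ.Nonempty},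
        withSign (C.shift 1) S.1 (pair A.q₂ S.1 (T.ιInfty S.1.card) (T.ιInfty S.1ᶜ.card)))

end TransferData

/-! ## Polynomial forms on the interval and the Thom-Whitney construction -/

/-- The linear map `p ↦ ∫₀ᵗ p` on `K[t]`. -/
noncomputable def polyInt (K : Type v) [Field K] : Polynomial K →ₗ[K] Polynomial K :=
  Polynomial.lsum fun n => (((n : K) + 1)⁻¹) • Polynomial.monomial (n + 1)

section PolyInt

variable {K : Type v} [Field K]

theorem polyInt_monomial (n : ℕ) (a : K) :
    polyInt K (Polynomial.monomial n a) = Polynomial.monomial (n + 1) (((n : K) + 1)⁻¹ * a) := by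
  simp [polyInt, Polynomial.lsum_apply, Polynomial.sum_monomial_index, Polynomial.smul_monomial]

theorem eval_zero_polyInt (p : Polynomial K) : (polyInt K p).eval 0 = 0 := by
  induction p using Polynomial.induction_on' with
  | add p q hp hq => simp [hp, hq]
  | monomial n a => rw [polyInt_monomial]; simp

theorem derivative_polyInt [CharZero K] (p : Polynomial K) :
    Polynomial.derivative (polyInt K p) = p := by
  induction p using Polynomial.induction_on' with
  | add p q hp hq => simp [hp, hq]
  | monomial n a =>
    have h : (n : K) + 1 ≠ 0 := by exact_mod_cast Nat.succ_ne_zero n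
    rw [polyInt_monomial, Polynomial.derivative_monomial]
    congr 1
    push_cast
    field_simp

theorem polyInt_derivative [CharZero K] (p : Polynomial K) :
    polyInt K (Polynomial.derivative p) = p - Polynomial.C (p.eval 0) := by
  induction p using Polynomial.induction_on' with
  | add p q hp hq => simp only [map_add, hp, hq, Polynomial.eval_add]; ring
  | monomial n a =>
    rw [Polynomial.derivative_monomial, polyInt_monomial]
    rcases n with _ | n
    · simp
    · have h : (n : K) + 1 ≠ 0 := by exact_mod_cast Nat.succ_ne_zero n
      simp only [Nat.add_sub_cancel, Polynomial.eval_monomial]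
      rw [zero_pow (Nat.succ_ne_zero n), mul_zero, map_zero, sub_zero]
      congr 1
      push_cast
      field_simp

end PolyInt

namespace GradedSpace

variable {K : Type v} [Field K]

/-- The graded vector space `V[t] = K[t] ⊗ V` of polynomials with coefficients in `V`. -/
noncomputable def poly (V : GradedSpace.{u} K) : GradedSpace.{max u v} K where
  carrier := Polynomial K ⊗[K] V
  deg i := LinearMap.range ((V.deg i).subtype.lTensor (Polynomial K))
  internal := by
    refine isInternal_of_proj _ (fun i => (V.proj i).lTensor (Polynomial K)) ?_ ?_ ?_ ?_
    · intro i x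
      refine ⟨((V.proj i).codRestrict (V.deg i) (V.proj_mem i)).lTensor (Polynomial K) x, ?_⟩
      rw [← LinearMap.comp_apply, ← LinearMap.lTensor_comp, LinearMap.subtype_comp_codRestrict]
    · rintro i _ ⟨x, rfl⟩
      rw [← LinearMap.comp_apply, ← LinearMap.lTensor_comp]
      congr 2
      ext y
      exact V.proj_of_mem y.2
    · rintro i j h _ ⟨x, rfl⟩
      rw [← LinearMap.comp_apply, ← LinearMap.lTensor_comp]
      have : V.proj i ∘ₗ (V.deg j).subtype = 0 := by
        ext y
        exact V.proj_of_mem_ne y.2 h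
      rw [this, LinearMap.lTensor_zero, LinearMap.zero_apply]
    · intro x
      have key : ∃ S : Finset ℤ, ∀ T : Finset ℤ, S ⊆ T →
          ∑ i ∈ T, (V.proj i).lTensor (Polynomial K) x = x := by
        induction x using TensorProduct.induction_on with
        | zero => exact ⟨∅, fun T _ => by simp⟩
        | tmul p y =>
          obtain ⟨S, hS⟩ := V.exists_sum_proj y
          refine ⟨S, fun T hT => ?_⟩
          simp only [LinearMap.lTensor_tmul]
          rw [← TensorProduct.tmul_sum, hS T hT]
        | add y z hy hz =>
          obtain ⟨S, hS⟩ := hy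
          obtain ⟨S', hS'⟩ := hz
          refine ⟨S ∪ S', fun T hT => ?_⟩
          simp only [map_add, Finset.sum_add_distrib]
          rw [hS T (Finset.union_subset_left hT), hS' T (Finset.union_subset_right hT)]
      obtain ⟨S, hS⟩ := key
      exact ⟨S, hS S (subset_refl _)⟩

/-- The value at `t = a` of a polynomial with coefficients in `V`. -/
noncomputable def polyEval (V : GradedSpace.{u} K) (a : K) : V.poly →ₗ[K] V :=
  (TensorProduct.lid K V).toLinearMap ∘ₗ (Polynomial.leval a).rTensor V

/-- The derivative `∂/∂t` on `V[t]`. -/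
noncomputable def polyDeriv (V : GradedSpace.{u} K) : V.poly →ₗ[K] V.poly :=
  (Polynomial.derivative (R := K)).rTensor V

/-- The primitive `P ↦ ∫₀ᵗ P` on `V[t]`. -/
noncomputable def polyPrim (V : GradedSpace.{u} K) : V.poly →ₗ[K] V.poly :=
  (polyInt K).rTensor V

/-- The polynomial `f ⊗ v` in `V[t]`. -/
noncomputable def mono (V : GradedSpace.{u} K) : Polynomial K →ₗ[K] V →ₗ[K] V.poly :=
  TensorProduct.mk K (Polynomial K) V

/-- The coefficientwise extension of a linear map to polynomials. -/
noncomputable def polyMap {V W : GradedSpace.{u} K} (f : V →ₗ[K] W) : V.poly →ₗ[K] W.poly :=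
  f.lTensor (Polynomial K)

/-- The extension of a bilinear map to polynomials, `(p ⊗ v, q ⊗ w) ↦ p q ⊗ β(v, w)`. -/
noncomputable def polyBilin {V : GradedSpace.{u} K} (β : V →ₗ[K] V →ₗ[K] V) :
    V.poly →ₗ[K] V.poly →ₗ[K] V.poly :=
  TensorProduct.map₂ (LinearMap.mul K (Polynomial K)) β

end GradedSpace

namespace GradedSpace

variable {K : Type v} [Field K]

theorem poly_induction (V : GradedSpace.{u} K) {i : ℤ} {p : V.poly → Prop} {x : V.poly}
    (hx : x ∈ V.poly.deg i) (zero : p 0) (add : ∀ y z, p y → p z → p (y + z))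
    (tmul : ∀ (f : Polynomial K) (y : V), y ∈ V.deg i → p (V.mono f y)) : p x := by
  obtain ⟨y, rfl⟩ := hx
  induction y using TensorProduct.induction_on with
  | zero => rw [map_zero]; exact zero
  | tmul f y => exact tmul f y.1 y.2
  | add y z hy hz => rw [map_add]; exact add _ _ hy hz

theorem poly_ind {V : GradedSpace.{u} K} {p : V.poly → Prop} (x : V.poly) (zero : p 0)
    (add : ∀ y z, p y → p z → p (y + z)) (mono : ∀ (f : Polynomial K) (y : V), p (V.mono f y)) :
    p x :=
  TensorProduct.induction_on (motive := p) x zero mono add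

theorem tmul_mem_poly (V : GradedSpace.{u} K) {i : ℤ} (f : Polynomial K) {y : V}
    (hy : y ∈ V.deg i) : V.mono f y ∈ V.poly.deg i :=
  ⟨f ⊗ₜ[K] (⟨y, hy⟩ : V.deg i), rfl⟩

@[simp] theorem polyEval_tmul (V : GradedSpace.{u} K) (a : K) (f : Polynomial K) (y : V) :
    V.polyEval a (V.mono f y) = f.eval a • y := rfl

@[simp] theorem polyDeriv_tmul (V : GradedSpace.{u} K) (f : Polynomial K) (y : V) :
    V.polyDeriv (V.mono f y) = V.mono (Polynomial.derivative f) y := rfl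

@[simp] theorem polyPrim_tmul (V : GradedSpace.{u} K) (f : Polynomial K) (y : V) :
    V.polyPrim (V.mono f y) = V.mono (polyInt K f) y := rfl

@[simp] theorem polyMap_tmul {V W : GradedSpace.{u} K} (g : V →ₗ[K] W) (f : Polynomial K) (y : V) :
    polyMap g (V.mono f y) = W.mono f (g y) := rfl

@[simp] theorem polyBilin_tmul {V : GradedSpace.{u} K} (β : V →ₗ[K] V →ₗ[K] V)
    (f g : Polynomial K) (y z : V) :
    polyBilin β (V.mono f y) (V.mono g z) = V.mono (f * g) (β y z) := rfl

theorem polyEval_mem (V : GradedSpace.{u} K) (a : K) {i : ℤ} {x : V.poly}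
    (hx : x ∈ V.poly.deg i) : V.polyEval a x ∈ V.deg i := by
  refine V.poly_induction (p := fun x => V.polyEval a x ∈ V.deg i) hx ?_ ?_ ?_
  · simp
  · intro y z hy hz; rw [map_add]; exact add_mem hy hz
  · intro f y hy; exact Submodule.smul_mem _ _ hy

theorem polyDeriv_mem (V : GradedSpace.{u} K) {i : ℤ} {x : V.poly}
    (hx : x ∈ V.poly.deg i) : V.polyDeriv x ∈ V.poly.deg i := by
  refine V.poly_induction (p := fun x => V.polyDeriv x ∈ V.poly.deg i) hx ?_ ?_ ?_
  · simp
  · intro y z hy hz; rw [map_add]; exact add_mem hy hz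
  · intro f y hy; exact V.tmul_mem_poly _ hy

theorem polyPrim_mem (V : GradedSpace.{u} K) {i : ℤ} {x : V.poly}
    (hx : x ∈ V.poly.deg i) : V.polyPrim x ∈ V.poly.deg i := by
  refine V.poly_induction (p := fun x => V.polyPrim x ∈ V.poly.deg i) hx ?_ ?_ ?_
  · simp
  · intro y z hy hz; rw [map_add]; exact add_mem hy hz
  · intro f y hy; exact V.tmul_mem_poly _ hy

theorem polyMap_mem {V W : GradedSpace.{u} K} (g : V →ₗ[K] W) {i j : ℤ}
    (hg : ∀ y ∈ V.deg i, g y ∈ W.deg j) {x : V.poly} (hx : x ∈ V.poly.deg i) :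
    polyMap g x ∈ W.poly.deg j := by
  refine V.poly_induction (p := fun x => polyMap g x ∈ W.poly.deg j) hx ?_ ?_ ?_
  · simp
  · intro y z hy hz; rw [map_add]; exact add_mem hy hz
  · intro f y hy; exact W.tmul_mem_poly _ (hg y hy)

theorem polyMap_sgn (V : GradedSpace.{u} K) {i : ℤ} {x : V.poly} (hx : x ∈ V.poly.deg i) :
    polyMap V.sgn x = i.negOnePow • x := by
  refine V.poly_induction (p := fun x => polyMap V.sgn x = i.negOnePow • x) hx ?_ ?_ ?_
  · simp
  · intro y z hy hz; rw [map_add, hy, hz, smul_add]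
  · intro f y hy
    rw [polyMap_tmul, V.sgn_of_mem hy]
    rcases Int.units_eq_one_or i.negOnePow with h | h <;> rw [h]
    · rw [one_smul, one_smul]
    · rw [Units.neg_smul, one_smul, Units.neg_smul, one_smul, map_neg]

theorem polyBilin_mem {V : GradedSpace.{u} K} (β : V →ₗ[K] V →ₗ[K] V) {i j k : ℤ}
    (hβ : ∀ y ∈ V.deg i, ∀ z ∈ V.deg j, β y z ∈ V.deg k) {x y : V.poly}
    (hx : x ∈ V.poly.deg i) (hy : y ∈ V.poly.deg j) : polyBilin β x y ∈ V.poly.deg k := by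
  refine V.poly_induction (p := fun x => polyBilin β x y ∈ V.poly.deg k) hx ?_ ?_ ?_
  · simp
  · intro a b ha hb; rw [map_add, LinearMap.add_apply]; exact add_mem ha hb
  · intro f a ha
    refine V.poly_induction (p := fun y => polyBilin β (V.mono f a) y ∈ V.poly.deg k) hy ?_ ?_ ?_
    · simp
    · intro b c hb hc; rw [map_add]; exact add_mem hb hc
    · intro g b hb; exact V.tmul_mem_poly _ (hβ a ha b hb)

theorem polyEval_polyBilin {V : GradedSpace.{u} K} (β : V →ₗ[K] V →ₗ[K] V) (a : K)
    (x y : V.poly) :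
    V.polyEval a (polyBilin β x y) = β (V.polyEval a x) (V.polyEval a y) := by
  induction x using GradedSpace.poly_ind with
  | zero => simp
  | add x x' hx hx' =>
    rw [map_add, LinearMap.add_apply, map_add, map_add, map_add, hx, hx', LinearMap.add_apply]
  | mono f b =>
    induction y using GradedSpace.poly_ind with
    | zero => simp
    | add y y' hy hy' => rw [map_add, map_add, map_add, map_add, hy, hy']
    | mono g c => simp [smul_smul, mul_comm]

theorem polyDeriv_polyBilin {V : GradedSpace.{u} K} (β : V →ₗ[K] V →ₗ[K] V) (x y : V.poly) :
    V.polyDeriv (polyBilin β x y) =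
      polyBilin β (V.polyDeriv x) y + polyBilin β x (V.polyDeriv y) := by
  induction x using GradedSpace.poly_ind with
  | zero => simp
  | add x x' hx hx' => simp only [map_add, LinearMap.add_apply, hx, hx']; abel
  | mono f b =>
    induction y using GradedSpace.poly_ind with
    | zero => simp
    | add y y' hy hy' => simp only [map_add, hy, hy']; abel
    | mono g c => simp

theorem polyEval_polyMap {V W : GradedSpace.{u} K} (g : V →ₗ[K] W) (a : K) (x : V.poly) :
    W.polyEval a (polyMap g x) = g (V.polyEval a x) := by
  induction x using GradedSpace.poly_ind with
  | zero => simp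
  | add x y hx hy => simp only [map_add, hx, hy]
  | mono f y => simp

theorem polyDeriv_polyMap {V W : GradedSpace.{u} K} (g : V →ₗ[K] W) (x : V.poly) :
    W.polyDeriv (polyMap g x) = polyMap g (V.polyDeriv x) := by
  induction x using GradedSpace.poly_ind with
  | zero => simp
  | add x y hx hy => simp only [map_add, hx, hy]
  | mono f y => simp

theorem polyPrim_polyMap {V W : GradedSpace.{u} K} (g : V →ₗ[K] W) (x : V.poly) :
    W.polyPrim (polyMap g x) = polyMap g (V.polyPrim x) := by
  induction x using GradedSpace.poly_ind with
  | zero => simp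
  | add x y hx hy => simp only [map_add, hx, hy]
  | mono f y => simp

theorem polyEval_zero_polyPrim (V : GradedSpace.{u} K) (x : V.poly) :
    V.polyEval 0 (V.polyPrim x) = 0 := by
  induction x using GradedSpace.poly_ind with
  | zero => simp
  | add x y hx hy => simp only [map_add, hx, hy, add_zero]
  | mono f y => simp [eval_zero_polyInt]

theorem polyDeriv_polyPrim [CharZero K] (V : GradedSpace.{u} K) (x : V.poly) :
    V.polyDeriv (V.polyPrim x) = x := by
  induction x using GradedSpace.poly_ind with
  | zero => simp
  | add x y hx hy => simp only [map_add, hx, hy]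
  | mono f y => simp [derivative_polyInt]

theorem polyPrim_polyDeriv [CharZero K] (V : GradedSpace.{u} K) (x : V.poly)
    (h : V.polyEval 0 x = 0) : V.polyPrim (V.polyDeriv x) = x := by
  suffices H : V.polyPrim (V.polyDeriv x) =
      x - V.mono 1 (V.polyEval 0 x) by
    rw [H, h, map_zero, sub_zero]
  clear h
  induction x using GradedSpace.poly_ind with
  | zero => simp
  | add x y hx hy => simp only [map_add, hx, hy]; abel
  | mono f y =>
    simp only [polyDeriv_tmul, polyPrim_tmul, polyInt_derivative, polyEval_tmul, map_sub,
      LinearMap.sub_apply, map_smul]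
    rw [← LinearMap.smul_apply, ← map_smul, ← Polynomial.C_mul', mul_one]

end GradedSpace

namespace DGLA

variable {K : Type v} [Field K]

theorem poly_skew (M : DGLA.{u} K) {i j : ℤ} {x y : M.poly} (hx : x ∈ M.poly.deg i)
    (hy : y ∈ M.poly.deg j) : GradedSpace.polyBilin M.br x y =
      -((i * j).negOnePow • GradedSpace.polyBilin M.br y x) := by
  refine M.poly_induction (p := fun x => GradedSpace.polyBilin M.br x y =
      -((i * j).negOnePow • GradedSpace.polyBilin M.br y x)) hx ?_ ?_ ?_
  · simp
  · intro a b ha hb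
    simp only [map_add, LinearMap.add_apply, ha, hb, smul_add]; abel
  · intro f a ha
    refine M.poly_induction (p := fun y => GradedSpace.polyBilin M.br (M.mono f a) y =
      -((i * j).negOnePow • GradedSpace.polyBilin M.br y (M.mono f a))) hy ?_ ?_ ?_
    · simp
    · intro b c hb hc
      simp only [map_add, LinearMap.add_apply, hb, hc, smul_add]; abel
    · intro g b hb
      simp only [GradedSpace.polyBilin_tmul]
      rw [M.skew i j a ha b hb, mul_comm f g]
      rcases Int.units_eq_one_or (i * j).negOnePow with h | h <;> rw [h] <;>
        simp [Units.neg_smul]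

theorem poly_jacobi (M : DGLA.{u} K) {i j k : ℤ} {x y z : M.poly} (hx : x ∈ M.poly.deg i)
    (hy : y ∈ M.poly.deg j) (hz : z ∈ M.poly.deg k) :
    GradedSpace.polyBilin M.br x (GradedSpace.polyBilin M.br y z) =
      GradedSpace.polyBilin M.br (GradedSpace.polyBilin M.br x y) z +
      (i * j).negOnePow • GradedSpace.polyBilin M.br y (GradedSpace.polyBilin M.br x z) := by
  refine M.poly_induction (p := fun x =>
    GradedSpace.polyBilin M.br x (GradedSpace.polyBilin M.br y z) =
      GradedSpace.polyBilin M.br (GradedSpace.polyBilin M.br x y) z +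
      (i * j).negOnePow • GradedSpace.polyBilin M.br y (GradedSpace.polyBilin M.br x z))
    hx ?_ ?_ ?_
  · simp
  · intro a b ha hb
    simp only [map_add, LinearMap.add_apply, ha, hb, smul_add]; abel
  · intro f a ha
    refine M.poly_induction (p := fun y =>
      GradedSpace.polyBilin M.br (M.mono f a) (GradedSpace.polyBilin M.br y z) =
      GradedSpace.polyBilin M.br (GradedSpace.polyBilin M.br (M.mono f a) y) z +
      (i * j).negOnePow • GradedSpace.polyBilin M.br y
        (GradedSpace.polyBilin M.br (M.mono f a) z)) hy ?_ ?_ ?_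
    · simp
    · intro b c hb hc
      simp only [map_add, LinearMap.add_apply, hb, hc, smul_add]; abel
    · intro g b hb
      refine M.poly_induction (p := fun z =>
        GradedSpace.polyBilin M.br (M.mono f a) (GradedSpace.polyBilin M.br (M.mono g b) z) =
        GradedSpace.polyBilin M.br (GradedSpace.polyBilin M.br (M.mono f a) (M.mono g b)) z +
        (i * j).negOnePow • GradedSpace.polyBilin M.br (M.mono g b)
          (GradedSpace.polyBilin M.br (M.mono f a) z)) hz ?_ ?_ ?_
      · simp
      · intro c e hc he
        simp only [map_add, hc, he, smul_add]; abel
      · intro r c hc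
        simp only [GradedSpace.polyBilin_tmul]
        rw [M.jacobi i j k a ha b hb c hc, mul_left_comm g f r, ← mul_assoc,
          map_add]
        rcases Int.units_eq_one_or (i * j).negOnePow with h | h <;> rw [h] <;>
          simp [Units.neg_smul]

theorem poly_leibniz (M : DGLA.{u} K) {i j : ℤ} {x y : M.poly} (hx : x ∈ M.poly.deg i)
    (hy : y ∈ M.poly.deg j) : GradedSpace.polyMap M.d (GradedSpace.polyBilin M.br x y) =
      GradedSpace.polyBilin M.br (GradedSpace.polyMap M.d x) y +
      i.negOnePow • GradedSpace.polyBilin M.br x (GradedSpace.polyMap M.d y) := by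
  refine M.poly_induction (p := fun x =>
    GradedSpace.polyMap M.d (GradedSpace.polyBilin M.br x y) =
      GradedSpace.polyBilin M.br (GradedSpace.polyMap M.d x) y +
      i.negOnePow • GradedSpace.polyBilin M.br x (GradedSpace.polyMap M.d y)) hx ?_ ?_ ?_
  · simp
  · intro a b ha hb
    simp only [map_add, LinearMap.add_apply, ha, hb, smul_add]; abel
  · intro f a ha
    refine M.poly_induction (p := fun y =>
      GradedSpace.polyMap M.d (GradedSpace.polyBilin M.br (M.mono f a) y) =
      GradedSpace.polyBilin M.br (GradedSpace.polyMap M.d (M.mono f a)) y +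
      i.negOnePow • GradedSpace.polyBilin M.br (M.mono f a) (GradedSpace.polyMap M.d y))
      hy ?_ ?_ ?_
    · simp
    · intro b c hb hc
      simp only [map_add, hb, hc, smul_add]; abel
    · intro g b hb
      simp only [GradedSpace.polyBilin_tmul, GradedSpace.polyMap_tmul]
      rw [M.leibniz i j a ha b hb, map_add]
      rcases Int.units_eq_one_or i.negOnePow with h | h <;> rw [h] <;>
        simp [Units.neg_smul]

theorem polyMap_d_d (M : DGLA.{u} K) (x : M.poly) :
    GradedSpace.polyMap M.d (GradedSpace.polyMap M.d x) = 0 := by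
  induction x using GradedSpace.poly_ind with
  | zero => simp
  | add x y hx hy => simp only [map_add, hx, hy, add_zero]
  | mono f y => simp [M.d_d]

end DGLA

namespace DGLAHom

variable {K : Type v} [Field K] {L M : DGLA.{u} K}

/-- The mapping cone `Tot(χ^Δ)` of `χ : L → M`, where `χ^Δ` is the semicosimplicial DGLA
`L ⇉ M → 0 ⋯` with `∂₀ = χ` and `∂₁ = 0`: one has `Tot(χ^Δ)ⁱ = Lⁱ ⊕ Mⁱ⁻¹` and
`d(l, m) = (dl, χ(l) - dm)`. -/
def cone (χ : DGLAHom L M) : DGSpace.{u} K where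
  toGradedSpace := L.prodShift M.toGradedSpace (-1)
  d := (L.d ∘ₗ LinearMap.fst K L.carrier M.carrier).prod
    (χ.toLinearMap ∘ₗ LinearMap.fst K L.carrier M.carrier -
      M.d ∘ₗ LinearMap.snd K L.carrier M.carrier)
  d_mem := by
    rintro i ⟨l, m⟩ ⟨hl, hm⟩
    refine ⟨L.d_mem i l hl, sub_mem ?_ ?_⟩
    · have := χ.map_mem i l hl
      rwa [show i = -1 + (i + 1) by ring] at this
    · have := M.d_mem _ m hm
      rwa [show -1 + i + 1 = -1 + (i + 1) by ring] at this
  d_d := by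
    rintro ⟨l, m⟩
    refine Prod.ext (L.d_d l) ?_
    change χ.toLinearMap (L.d l) - M.d (χ.toLinearMap l - M.d m) = 0
    rw [map_sub, M.d_d, χ.map_d, sub_zero, sub_self]

/-- The underlying vector space of `Tot_TW(χ^Δ)`. Its elements are the pairs of `l ∈ L` and a
polynomial form `P + dt Q` on the interval with coefficients in `M`, here written `(l, P, Q)`, such
that `P(0) = ∂₁ l = 0` and `P(1) = ∂₀ l = χ(l)`. (The interval is the standard `1`-simplex, with
`t = t₁ = 1 - t₀`.) -/
noncomputable def twSubmodule (χ : DGLAHom L M) :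
    Submodule K (L.carrier × M.poly.carrier × M.poly.carrier) where
  carrier := {x | M.polyEval 0 x.2.1 = 0 ∧ M.polyEval 1 x.2.1 = χ.toLinearMap x.1}
  zero_mem' := by simp
  add_mem' := by
    rintro x y ⟨hx, hx'⟩ ⟨hy, hy'⟩
    constructor
    · rw [Prod.snd_add, Prod.fst_add, map_add, hx, hy, add_zero]
    · rw [Prod.snd_add, Prod.fst_add, Prod.fst_add, map_add, map_add, hx', hy']
  smul_mem' := by
    rintro c x ⟨hx, hx'⟩
    constructor
    · rw [Prod.smul_snd, Prod.smul_fst, map_smul, hx, smul_zero]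
    · rw [Prod.smul_snd, Prod.smul_fst, Prod.smul_fst, map_smul, map_smul, hx']

theorem map_proj (χ : DGLAHom L M) (i : ℤ) (x : L.carrier) :
    χ.toLinearMap (L.proj i x) = M.proj i (χ.toLinearMap x) := by
  refine L.induction (p := fun x => χ.toLinearMap (L.proj i x) = M.proj i (χ.toLinearMap x))
    x ?_ ?_ ?_
  · intro j y hy
    by_cases h : j = i
    · subst h; rw [L.proj_of_mem hy, M.proj_of_mem (χ.map_mem _ y hy)]
    · rw [L.proj_of_mem_ne hy h, M.proj_of_mem_ne (χ.map_mem _ y hy) h, map_zero]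
  · simp
  · intro y z hy hz; simp only [map_add, hy, hz]

theorem polyEval_proj (M : DGLA.{u} K) (a : K) (i : ℤ) (x : M.poly) :
    M.polyEval a (M.poly.proj i x) = M.proj i (M.polyEval a x) := by
  refine M.poly.induction (p := fun x => M.polyEval a (M.poly.proj i x) =
    M.proj i (M.polyEval a x)) x ?_ ?_ ?_
  · intro j y hy
    by_cases h : j = i
    · subst h; rw [M.poly.proj_of_mem hy, M.proj_of_mem (M.polyEval_mem a hy)]
    · rw [M.poly.proj_of_mem_ne hy h, M.proj_of_mem_ne (M.polyEval_mem a hy) h, map_zero]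
  · simp
  · intro y z hy hz; simp only [map_add, hy, hz]

/-- The componentwise projections of `Tot_TW(χ^Δ)` onto its homogeneous parts. -/
noncomputable def twProj (χ : DGLAHom L M) (i : ℤ) : χ.twSubmodule →ₗ[K] χ.twSubmodule :=
  ((L.proj i).prodMap ((M.poly.proj i).prodMap (M.poly.proj (-1 + i)))).restrict (by
    rintro ⟨l, P, Q⟩ ⟨h0, h1⟩
    change M.polyEval 0 P = 0 at h0
    change M.polyEval 1 P = χ.toLinearMap l at h1
    constructor
    · change M.polyEval 0 (M.poly.proj i P) = 0
      rw [polyEval_proj, h0, map_zero]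
    · change M.polyEval 1 (M.poly.proj i P) = χ.toLinearMap (L.proj i l)
      rw [polyEval_proj, map_proj, h1])

/-- The part of degree `i` of `Tot_TW(χ^Δ)`: the triples `(l, P, Q)` such that `l` and the
coefficients of `P` have degree `i` and those of `Q` have degree `i - 1`. -/
noncomputable def twDeg (χ : DGLAHom L M) (i : ℤ) : Submodule K χ.twSubmodule :=
  ((L.deg i).prod ((M.poly.deg i).prod (M.poly.deg (-1 + i)))).comap χ.twSubmodule.subtype

theorem twDeg_internal (χ : DGLAHom L M) : DirectSum.IsInternal χ.twDeg := by
  refine GradedSpace.isInternal_of_proj _ χ.twProj ?_ ?_ ?_ ?_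
  · intro i x
    exact ⟨L.proj_mem _ _, M.poly.proj_mem _ _, M.poly.proj_mem _ _⟩
  · rintro i x ⟨h1, h2, h3⟩
    exact Subtype.ext (Prod.ext (L.proj_of_mem h1)
      (Prod.ext (M.poly.proj_of_mem h2) (M.poly.proj_of_mem h3)))
  · rintro i j h x ⟨h1, h2, h3⟩
    exact Subtype.ext (Prod.ext (L.proj_of_mem_ne h1 h)
      (Prod.ext (M.poly.proj_of_mem_ne h2 h)
        (M.poly.proj_of_mem_ne h3 fun e => h (by linarith))))
  · intro x
    obtain ⟨S, hS⟩ := L.exists_sum_proj x.1.1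
    obtain ⟨S', hS'⟩ := M.poly.exists_sum_proj x.1.2.1
    obtain ⟨S'', hS''⟩ := M.poly.exists_sum_proj_shift (-1) x.1.2.2
    refine ⟨S ∪ (S' ∪ S''), Subtype.ext ?_⟩
    rw [AddSubmonoidClass.coe_finsetSum]
    refine Prod.ext ?_ (Prod.ext ?_ ?_)
    · rw [Prod.fst_sum]; exact hS _ Finset.subset_union_left
    · rw [Prod.snd_sum, Prod.fst_sum]
      exact hS' _ (Finset.subset_union_left.trans Finset.subset_union_right)
    · rw [Prod.snd_sum, Prod.snd_sum]
      exact hS'' _ (Finset.subset_union_right.trans Finset.subset_union_right)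

/-- The graded vector space `Tot_TW(χ^Δ)`. -/
noncomputable def twSpace (χ : DGLAHom L M) : GradedSpace.{max u v} K where
  carrier := χ.twSubmodule
  deg := χ.twDeg
  internal := χ.twDeg_internal

/-- The complex `Tot_TW(χ^Δ)`, with differential `d(l, P + dt Q) = (dl, dP + dt(P' - dQ))`. -/
noncomputable def twComplex (χ : DGLAHom L M) : DGSpace.{max u v} K where
  toGradedSpace := χ.twSpace
  d := LinearMap.codRestrict χ.twSubmodule
    ({ toFun := fun x => (L.d x.1.1, GradedSpace.polyMap M.d x.1.2.1,
          M.polyDeriv x.1.2.1 - GradedSpace.polyMap M.d x.1.2.2)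
       map_add' := fun x y => by
        refine Prod.ext (map_add _ _ _) (Prod.ext (map_add _ _ _) ?_)
        simp only [Submodule.coe_add, Prod.snd_add, Prod.fst_add, map_add]
        abel
       map_smul' := fun c x => by
        refine Prod.ext (map_smul _ _ _) (Prod.ext (map_smul _ _ _) ?_)
        simp only [Submodule.coe_smul, Prod.smul_snd, Prod.smul_fst, map_smul, smul_sub,
          RingHom.id_apply] } :
      χ.twSubmodule →ₗ[K] L.carrier × M.poly.carrier × M.poly.carrier)
    (by
      rintro ⟨⟨l, P, Q⟩, h0, h1⟩
      constructor
      · change M.polyEval 0 (GradedSpace.polyMap M.d P) = 0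
        rw [GradedSpace.polyEval_polyMap]
        exact (congrArg M.d h0).trans (map_zero _)
      · change M.polyEval 1 (GradedSpace.polyMap M.d P) = χ.toLinearMap (L.d l)
        rw [GradedSpace.polyEval_polyMap, χ.map_d]
        exact congrArg M.d h1)
  d_mem := by
    rintro i ⟨⟨l, P, Q⟩, _⟩ ⟨h1, h2, h3⟩
    refine ⟨L.d_mem i _ h1, GradedSpace.polyMap_mem _ (M.d_mem i) h2, sub_mem ?_ ?_⟩
    · have := M.polyDeriv_mem h2
      rw [show i = -1 + (i + 1) by ring] at this
      exact this
    · have := GradedSpace.polyMap_mem _ (M.d_mem (-1 + i)) h3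
      rw [show -1 + i + 1 = -1 + (i + 1) by ring] at this
      exact this
  d_d := by
    rintro ⟨⟨l, P, Q⟩, _⟩
    refine Subtype.ext (Prod.ext (L.d_d l) (Prod.ext (M.polyMap_d_d P) ?_))
    change M.polyDeriv (GradedSpace.polyMap M.d P) -
      GradedSpace.polyMap M.d (M.polyDeriv P - GradedSpace.polyMap M.d Q) = 0
    rw [map_sub, M.polyMap_d_d, GradedSpace.polyDeriv_polyMap, sub_zero, sub_self]

/-- The bracket of `Tot_TW(χ^Δ)`, on all triples: by the sign rule
`[P₁ + dt Q₁, P₂ + dt Q₂] = [P₁, P₂] + dt([Q₁, P₂] + (-1)^{deg P₁} [P₁, Q₂])`. -/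
noncomputable def twBr (L M : DGLA.{u} K) (x y : L.carrier × M.poly.carrier × M.poly.carrier) :
    L.carrier × M.poly.carrier × M.poly.carrier :=
  (L.br x.1 y.1, GradedSpace.polyBilin M.br x.2.1 y.2.1,
    GradedSpace.polyBilin M.br x.2.2 y.2.1 +
      GradedSpace.polyBilin M.br (GradedSpace.polyMap M.sgn x.2.1) y.2.2)

theorem twBr_mem (χ : DGLAHom L M) {x y : L.carrier × M.poly.carrier × M.poly.carrier}
    (hx : x ∈ χ.twSubmodule) (hy : y ∈ χ.twSubmodule) : twBr L M x y ∈ χ.twSubmodule := by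
  obtain ⟨hx0, hx1⟩ := hx
  obtain ⟨hy0, hy1⟩ := hy
  constructor
  · simp only [twBr]
    rw [GradedSpace.polyEval_polyBilin, hx0, map_zero, LinearMap.zero_apply]
  · simp only [twBr]
    rw [GradedSpace.polyEval_polyBilin, hx1, hy1, χ.map_br]

/-- The bracket of `Tot_TW(χ^Δ)`. -/
noncomputable def twBracket (χ : DGLAHom L M) :
    χ.twSubmodule →ₗ[K] χ.twSubmodule →ₗ[K] χ.twSubmodule :=
  LinearMap.mk₂ K
    (fun x y : χ.twSubmodule => (⟨twBr L M x.1 y.1, χ.twBr_mem x.2 y.2⟩ : χ.twSubmodule))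
    (by
      intro x x' y
      refine Subtype.ext (Prod.ext ?_ (Prod.ext ?_ ?_)) <;>
        simp only [twBr, Submodule.coe_add, Prod.snd_add, Prod.fst_add, map_add,
          LinearMap.add_apply]
      abel)
    (by
      intro c x y
      refine Subtype.ext (Prod.ext ?_ (Prod.ext ?_ ?_)) <;>
        simp only [twBr, Submodule.coe_smul, Prod.smul_snd, Prod.smul_fst, map_smul,
          LinearMap.smul_apply, smul_add])
    (by
      intro x y y'
      refine Subtype.ext (Prod.ext ?_ (Prod.ext ?_ ?_)) <;>
        simp only [twBr, Submodule.coe_add, Prod.snd_add, Prod.fst_add, map_add]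
      abel)
    (by
      intro c x y
      refine Subtype.ext (Prod.ext ?_ (Prod.ext ?_ ?_)) <;>
        simp only [twBr, Submodule.coe_smul, Prod.smul_snd, Prod.smul_fst, map_smul, smul_add])

/-- The Thom-Whitney DGLA `Tot_TW(χ^Δ)`. -/
noncomputable def thomWhitney (χ : DGLAHom L M) : DGLA.{max u v} K where
  toDGSpace := χ.twComplex
  br := χ.twBracket
  br_mem := by
    rintro i j ⟨⟨l, P, Q⟩, _⟩ ⟨h1, h2, h3⟩ ⟨⟨l', P', Q'⟩, _⟩ ⟨h1', h2', h3'⟩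
    refine ⟨L.br_mem i j _ h1 _ h1', GradedSpace.polyBilin_mem _ (M.br_mem i j) h2 h2',
      add_mem ?_ ?_⟩
    · exact GradedSpace.polyBilin_mem _
        (fun y hy z hz => by
          have := M.br_mem (-1 + i) j y hy z hz
          rwa [show -1 + i + j = -1 + (i + j) by ring] at this) h3 h2'
    · exact GradedSpace.polyBilin_mem _
        (fun y hy z hz => by
          have := M.br_mem i (-1 + j) y hy z hz
          rwa [show i + (-1 + j) = -1 + (i + j) by ring] at this)
        (GradedSpace.polyMap_mem _
          (fun y hy => by
            rw [M.sgn_of_mem hy, Units.smul_def]; exact zsmul_mem hy _) h2) h3'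
  skew := by
    rintro i j ⟨⟨l, P, Q⟩, _⟩ ⟨h1, h2, h3⟩ ⟨⟨l', P', Q'⟩, _⟩ ⟨h1', h2', h3'⟩
    replace h2 : P ∈ M.poly.deg i := h2
    replace h3 : Q ∈ M.poly.deg (-1 + i) := h3
    replace h2' : P' ∈ M.poly.deg j := h2'
    replace h3' : Q' ∈ M.poly.deg (-1 + j) := h3'
    refine Subtype.ext (Prod.ext (L.skew i j _ h1 _ h1')
      (Prod.ext (M.poly_skew h2 h2') ?_))
    change GradedSpace.polyBilin M.br Q P' +
        GradedSpace.polyBilin M.br (GradedSpace.polyMap M.sgn P) Q' =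
      -((i * j).negOnePow • (GradedSpace.polyBilin M.br Q' P +
        GradedSpace.polyBilin M.br (GradedSpace.polyMap M.sgn P') Q))
    have e1 := M.poly_skew h3 h2'
    have e2 := M.poly_skew h2 h3'
    rw [M.polyMap_sgn h2, M.polyMap_sgn h2']
    rw [add_mul, neg_one_mul, Int.negOnePow_add, Int.negOnePow_neg] at e1
    rw [mul_add, mul_neg_one, Int.negOnePow_add, Int.negOnePow_neg] at e2
    rcases Int.units_eq_one_or i.negOnePow with hi | hi <;>
    rcases Int.units_eq_one_or j.negOnePow with hj | hj <;>
    rcases Int.units_eq_one_or (i * j).negOnePow with hij | hij <;>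
    simp only [hi, hj, hij, one_smul, Units.neg_smul, mul_one, mul_neg, neg_neg,
      map_neg, LinearMap.neg_apply] at e1 e2 ⊢ <;>
    rw [e1, e2] <;> abel
  jacobi := by
    rintro i j k ⟨⟨l, P, Q⟩, _⟩ ⟨h1, h2, h3⟩ ⟨⟨l', P', Q'⟩, _⟩ ⟨h1', h2', h3'⟩
      ⟨⟨l'', P'', Q''⟩, _⟩ ⟨h1'', h2'', h3''⟩
    replace h2 : P ∈ M.poly.deg i := h2
    replace h3 : Q ∈ M.poly.deg (-1 + i) := h3
    replace h2' : P' ∈ M.poly.deg j := h2'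
    replace h3' : Q' ∈ M.poly.deg (-1 + j) := h3'
    replace h2'' : P'' ∈ M.poly.deg k := h2''
    replace h3'' : Q'' ∈ M.poly.deg (-1 + k) := h3''
    refine Subtype.ext (Prod.ext (L.jacobi i j k _ h1 _ h1' _ h1'')
      (Prod.ext (M.poly_jacobi h2 h2' h2'') ?_))
    have hPP : GradedSpace.polyBilin M.br P P' ∈ M.poly.deg (i + j) :=
      GradedSpace.polyBilin_mem _ (M.br_mem i j) h2 h2'
    change GradedSpace.polyBilin M.br Q (GradedSpace.polyBilin M.br P' P'') +
        GradedSpace.polyBilin M.br (GradedSpace.polyMap M.sgn P)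
          (GradedSpace.polyBilin M.br Q' P'' +
            GradedSpace.polyBilin M.br (GradedSpace.polyMap M.sgn P') Q'') =
      GradedSpace.polyBilin M.br (GradedSpace.polyBilin M.br Q P' +
            GradedSpace.polyBilin M.br (GradedSpace.polyMap M.sgn P) Q') P'' +
        GradedSpace.polyBilin M.br
          (GradedSpace.polyMap M.sgn (GradedSpace.polyBilin M.br P P')) Q'' +
      (i * j).negOnePow • (GradedSpace.polyBilin M.br Q' (GradedSpace.polyBilin M.br P P'') +
        GradedSpace.polyBilin M.br (GradedSpace.polyMap M.sgn P')
          (GradedSpace.polyBilin M.br Q P'' +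
            GradedSpace.polyBilin M.br (GradedSpace.polyMap M.sgn P) Q''))
    have e1 := M.poly_jacobi h3 h2' h2''
    have e2 := M.poly_jacobi h2 h3' h2''
    have e3 := M.poly_jacobi h2 h2' h3''
    rw [M.polyMap_sgn h2, M.polyMap_sgn h2', M.polyMap_sgn hPP, Int.negOnePow_add]
    rw [add_mul, neg_one_mul, Int.negOnePow_add, Int.negOnePow_neg] at e1
    rw [mul_add, mul_neg_one, Int.negOnePow_add, Int.negOnePow_neg] at e2
    rcases Int.units_eq_one_or i.negOnePow with hi | hi <;>
    rcases Int.units_eq_one_or j.negOnePow with hj | hj <;>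
    rcases Int.units_eq_one_or (i * j).negOnePow with hij | hij <;>
    simp only [hi, hj, hij, one_smul, Units.neg_smul, mul_one, mul_neg, neg_neg,
      map_neg, LinearMap.neg_apply, map_add, LinearMap.add_apply] at e1 e2 e3 ⊢ <;>
    rw [e1, e2, e3] <;> abel
  leibniz := by
    rintro i j ⟨⟨l, P, Q⟩, _⟩ ⟨h1, h2, h3⟩ ⟨⟨l', P', Q'⟩, _⟩ ⟨h1', h2', h3'⟩
    replace h2 : P ∈ M.poly.deg i := h2
    replace h3 : Q ∈ M.poly.deg (-1 + i) := h3
    replace h2' : P' ∈ M.poly.deg j := h2'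
    replace h3' : Q' ∈ M.poly.deg (-1 + j) := h3'
    refine Subtype.ext (Prod.ext (L.leibniz i j _ h1 _ h1')
      (Prod.ext (M.poly_leibniz h2 h2') ?_))
    have hdP : GradedSpace.polyMap M.d P ∈ M.poly.deg (i + 1) :=
      GradedSpace.polyMap_mem _ (M.d_mem i) h2
    change M.polyDeriv (GradedSpace.polyBilin M.br P P') -
        GradedSpace.polyMap M.d (GradedSpace.polyBilin M.br Q P' +
          GradedSpace.polyBilin M.br (GradedSpace.polyMap M.sgn P) Q') =
      GradedSpace.polyBilin M.br (M.polyDeriv P - GradedSpace.polyMap M.d Q) P' +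
        GradedSpace.polyBilin M.br (GradedSpace.polyMap M.sgn (GradedSpace.polyMap M.d P)) Q' +
      i.negOnePow • (GradedSpace.polyBilin M.br Q (GradedSpace.polyMap M.d P') +
        GradedSpace.polyBilin M.br (GradedSpace.polyMap M.sgn P)
          (M.polyDeriv P' - GradedSpace.polyMap M.d Q'))
    have e1 := M.poly_leibniz h3 h2'
    have e2 := M.poly_leibniz h2 h3'
    rw [M.polyMap_sgn h2, M.polyMap_sgn hdP, GradedSpace.polyDeriv_polyBilin, Int.negOnePow_succ]
    rw [Int.negOnePow_add, Int.negOnePow_neg, Int.negOnePow_one] at e1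
    rcases Int.units_eq_one_or i.negOnePow with hi | hi <;>
    simp only [hi, one_smul, Units.neg_smul, mul_one, mul_neg, neg_neg,
      map_neg, LinearMap.neg_apply, map_add, map_sub, LinearMap.sub_apply]
      at e1 e2 ⊢ <;>
    rw [e1, e2] <;> abel

/-- Whitney's integration map `I(l, P + dt Q) = (l, ∫₀¹ Q)`. -/
noncomputable def whitneyI (χ : DGLAHom L M) : χ.thomWhitney.carrier →ₗ[K] χ.cone.carrier :=
  (LinearMap.id.prodMap (M.polyEval 1 ∘ₗ M.polyPrim ∘ₗ LinearMap.snd K _ _)) ∘ₗ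
    χ.twSubmodule.subtype

/-- Whitney's map `E(l, m) = (l, t χ(l) + dt m)`. -/
noncomputable def whitneyE (χ : DGLAHom L M) : χ.cone.carrier →ₗ[K] χ.thomWhitney.carrier :=
  LinearMap.codRestrict χ.twSubmodule
    ((LinearMap.fst K L.carrier M.carrier).prod
      ((M.mono Polynomial.X ∘ₗ χ.toLinearMap ∘ₗ LinearMap.fst K L.carrier M.carrier).prod
        (M.mono 1 ∘ₗ LinearMap.snd K L.carrier M.carrier)))
    (by
      rintro ⟨l, m⟩
      constructor
      · change M.polyEval 0 (M.mono Polynomial.X (χ.toLinearMap l)) = 0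
        simp
      · change M.polyEval 1 (M.mono Polynomial.X (χ.toLinearMap l)) = χ.toLinearMap l
        simp)

/-- Dupont's homotopy, with the sign that it has on `Tot_TW(χ^Δ)[1]`:
`h(l, P + dt Q) = (0, ∫₀ᵗ Q - t ∫₀¹ Q)`. -/
noncomputable def dupontH (χ : DGLAHom L M) :
    χ.thomWhitney.carrier →ₗ[K] χ.thomWhitney.carrier :=
  LinearMap.codRestrict χ.twSubmodule
    ((LinearMap.inr K L.carrier (M.poly.carrier × M.poly.carrier) ∘ₗ
      LinearMap.inl K M.poly.carrier M.poly.carrier ∘ₗ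
      (M.polyPrim - M.mono Polynomial.X ∘ₗ M.polyEval 1 ∘ₗ M.polyPrim) ∘ₗ
      LinearMap.snd K _ _ ∘ₗ LinearMap.snd K _ _) ∘ₗ χ.twSubmodule.subtype)
    (by
      rintro ⟨⟨l, P, Q⟩, _⟩
      constructor
      · change M.polyEval 0 (M.polyPrim Q - M.mono Polynomial.X (M.polyEval 1 (M.polyPrim Q))) = 0
        rw [map_sub, M.polyEval_zero_polyPrim]
        simp
      · change M.polyEval 1 (M.polyPrim Q - M.mono Polynomial.X (M.polyEval 1 (M.polyPrim Q))) =
          χ.toLinearMap 0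
        simp)

/-- The maps `I`, `E` and `h` are data for homotopy transfer from the DGLA `Tot_TW(χ^Δ)` to the
complex `Tot(χ^Δ)`. -/
noncomputable def transferData [CharZero K] (χ : DGLAHom L M) :
    TransferData χ.thomWhitney χ.cone where
  π := χ.whitneyI
  ι := χ.whitneyE
  h := χ.dupontH
  π_mem := by
    rintro i ⟨⟨l, P, Q⟩, _⟩ ⟨h1, h2, h3⟩
    refine ⟨h1, ?_⟩
    exact M.polyEval_mem 1 (M.polyPrim_mem h3)
  ι_mem := by
    rintro i ⟨l, m⟩ ⟨h1, h2⟩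
    refine ⟨h1, M.tmul_mem_poly _ (χ.map_mem i l h1), M.tmul_mem_poly _ h2⟩
  h_mem := by
    rintro i ⟨⟨l, P, Q⟩, _⟩ ⟨h1, h2, h3⟩
    rw [show -1 + i = i - 1 by ring] at h3
    exact ⟨zero_mem _, sub_mem (M.polyPrim_mem h3)
      (M.tmul_mem_poly _ (M.polyEval_mem 1 (M.polyPrim_mem h3))), zero_mem _⟩
  π_d := by
    rintro ⟨⟨l, P, Q⟩, h0, h1⟩
    change M.polyEval 0 P = 0 at h0
    change M.polyEval 1 P = χ.toLinearMap l at h1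
    refine Prod.ext rfl ?_
    change M.polyEval 1 (M.polyPrim (M.polyDeriv P - GradedSpace.polyMap M.d Q)) =
      χ.toLinearMap l - M.d (M.polyEval 1 (M.polyPrim Q))
    rw [map_sub, map_sub, M.polyPrim_polyDeriv P h0, h1, GradedSpace.polyPrim_polyMap,
      GradedSpace.polyEval_polyMap]
  ι_d := by
    rintro ⟨l, m⟩
    refine Subtype.ext (Prod.ext rfl (Prod.ext ?_ ?_))
    · change M.mono Polynomial.X (χ.toLinearMap (L.d l)) =
        GradedSpace.polyMap M.d (M.mono Polynomial.X (χ.toLinearMap l))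
      rw [GradedSpace.polyMap_tmul, χ.map_d]
    · change M.mono 1 (χ.toLinearMap l - M.d m) =
        M.polyDeriv (M.mono Polynomial.X (χ.toLinearMap l)) -
          GradedSpace.polyMap M.d (M.mono 1 m)
      rw [GradedSpace.polyMap_tmul, GradedSpace.polyDeriv_tmul, Polynomial.derivative_X, map_sub]
  homotopy := by
    rintro ⟨⟨l, P, Q⟩, h0, h1⟩
    change M.polyEval 0 P = 0 at h0
    change M.polyEval 1 P = χ.toLinearMap l at h1
    refine Subtype.ext (Prod.ext ?_ (Prod.ext ?_ ?_))
    · change 0 + -(L.d 0) = l - l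
      simp
    · change (M.polyPrim (-(M.polyDeriv P - GradedSpace.polyMap M.d Q)) -
          M.mono Polynomial.X
            (M.polyEval 1 (M.polyPrim (-(M.polyDeriv P - GradedSpace.polyMap M.d Q))))) +
        -(GradedSpace.polyMap M.d
          (M.polyPrim Q - M.mono Polynomial.X (M.polyEval 1 (M.polyPrim Q)))) =
        M.mono Polynomial.X (χ.toLinearMap l) - P
      simp only [map_neg, map_sub, M.polyPrim_polyDeriv P h0, h1, GradedSpace.polyPrim_polyMap,
        GradedSpace.polyEval_polyMap, GradedSpace.polyMap_tmul]
      abel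
    · change 0 + -(M.polyDeriv (M.polyPrim Q -
          M.mono Polynomial.X (M.polyEval 1 (M.polyPrim Q))) - GradedSpace.polyMap M.d 0) =
        M.mono 1 (M.polyEval 1 (M.polyPrim Q)) - Q
      rw [map_sub, M.polyDeriv_polyPrim, GradedSpace.polyDeriv_tmul, Polynomial.derivative_X,
        map_zero, sub_zero, zero_add, neg_sub]

/-- The brackets of the canonical `L∞` structure on the mapping cone `Tot(χ^Δ)`. They are obtained
by homotopy transfer from the DGLA `Tot_TW(χ^Δ)` along `I`, `E` and `h`. -/
noncomputable def coneBracket [CharZero K] (χ : DGLAHom L M) (n : ℕ) :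
    MultilinearMap K (fun _ : Fin n => χ.cone.carrier) χ.cone.carrier :=
  χ.transferData.bracket n

end DGLAHom

/-!
The proof has two independent halves.

*The transferred brackets satisfy the `L∞` relations*
(`TransferData.isLInfinity_bracket`, valid for every `TransferData`). Think of a formal even
element `x` of `C[1]`, put `φ(x) = ½ q₂(ι_∞(x), ι_∞(x))`, so that `ι_∞(x) = ι(x) + h φ(x)`, and let
`μ(x) = -d x + π φ(x)` be the vector field given by the brackets and `R(y) = q₁ y + ½ q₂(y, y)` the
curvature. The Leibniz rule and the Jacobi identity yield the Bianchi identity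
`q₁ φ = -q₂(R(ι_∞), ι_∞)` (`q₁_quad_eq_curvature`). With `h q₁ + q₁ h = ι π - Id` it gives
`R(ι_∞) = ι μ + h q₂(R(ι_∞), ι_∞)` (`curvature_eq`), and the derivative of `ι_∞` along `μ` satisfies
the same recursion (`pushforward_eq`). Hence the two agree (`pushforward_eq_curvature`), and
the derivative of `μ` along itself is `-d μ + π q₂(R(ι_∞), ι_∞) = -d π φ - π q₁ φ = 0`
(`sum_bracket_bracket`). No side conditions on `h` are needed.

In place of a formal element, a tuple `v₁, …, vₙ` of homogeneous elements is fixed, and a series is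
given by its coefficients, a family indexed by the subsets `B` of `{1, …, n}`: the value of its
multilinear components on `v_B`. Products become sums over the splittings of `B` into two parts,
with the Koszul sign `listSign`, which is multiplicative in both parts.

*The cone is quasi-abelian* (`DGLAHom.isQuasiAbelian_cone`). As `E(0, m) = dt m` and `dt dt = 0`,
all brackets of arity at least two vanish on `M[-1] ⊆ Tot(χ^Δ)`. Since `χ` is injective in cohomology,
the long exact sequence of the cone shows that the cohomology of `M[-1]` surjects onto that of the
cone. So one can choose a graded space `H` of cocycles of `M[-1]` which maps isomorphically onto
the cohomology of the cone (`exists_representatives`), and the inclusion of `H`, with zero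
brackets, is an `L∞` quasi-isomorphism (`strictMorphism`). Working with `H` inside `M`
keeps the zigzag in the universe of `L` and `M`, while the Thom-Whitney algebra may live in a larger
one.
-/

/-! ### Sums over the splittings of a finite set into two parts -/

theorem Finset.sum_powerset_map {ι κ : Type*} [DecidableEq κ] {N : Type*} [AddCommMonoid N]
    (e : ι ↪ κ) (A : Finset ι) (f : Finset κ → N) :
    ∑ S ∈ (A.map e).powerset, f S = ∑ S ∈ A.powerset, f (S.map e) := by
  symm
  refine Finset.sum_bij (fun S _ => S.map e) ?_ ?_ ?_ ?_
  · intro S hS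
    simpa using hS
  · intro S _ T _ h
    exact Finset.map_injective e h
  · intro S hS
    obtain ⟨T, hT, rfl⟩ := Finset.subset_map_iff.1 (Finset.mem_powerset.1 hS)
    exact ⟨T, Finset.mem_powerset.2 hT, rfl⟩
  · intro S _; rfl

section Splittings

variable {ι : Type*} [DecidableEq ι] {N : Type*} [AddCommMonoid N]

theorem Finset.sum_powerset_sdiff_comm (A : Finset ι) (f : Finset ι → Finset ι → N) :
    ∑ S ∈ A.powerset, f S (A \ S) = ∑ S ∈ A.powerset, f (A \ S) S := by
  refine Finset.sum_nbij' (fun S => A \ S) (fun S => A \ S) ?_ ?_ ?_ ?_ ?_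
  · intro S _; simp
  · intro S _; simp
  · intro S hS; exact Finset.sdiff_sdiff_eq_self (Finset.mem_powerset.1 hS)
  · intro S hS; exact Finset.sdiff_sdiff_eq_self (Finset.mem_powerset.1 hS)
  · intro S hS
    simp only [Finset.sdiff_sdiff_eq_self (Finset.mem_powerset.1 hS)]

/-- The two ways of splitting `A` into three parts by successive splittings into two parts. -/
theorem Finset.sum_powerset_sdiff_assoc (A : Finset ι)
    (f : Finset ι → Finset ι → Finset ι → N) :
    ∑ S ∈ A.powerset, ∑ T ∈ (A \ S).powerset, f S T ((A \ S) \ T) =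
      ∑ V ∈ A.powerset, ∑ S ∈ V.powerset, f S (V \ S) (A \ V) := by
  rw [Finset.sum_sigma', Finset.sum_sigma']
  refine Finset.sum_nbij' (fun x => ⟨x.1 ∪ x.2, x.1⟩) (fun x => ⟨x.2, x.1 \ x.2⟩) ?_ ?_ ?_ ?_ ?_
  · rintro ⟨S, T⟩ h
    simp only [Finset.mem_sigma, Finset.mem_powerset, Finset.subset_sdiff] at h ⊢
    exact ⟨Finset.union_subset h.1 h.2.1, Finset.subset_union_left⟩
  · rintro ⟨V, S⟩ h
    simp only [Finset.mem_sigma, Finset.mem_powerset] at h ⊢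
    exact ⟨h.2.trans h.1, Finset.sdiff_subset_sdiff h.1 le_rfl⟩
  · rintro ⟨S, T⟩ h
    simp only [Finset.mem_sigma, Finset.mem_powerset, Finset.subset_sdiff] at h ⊢
    rw [Finset.union_sdiff_cancel_left h.2.2.symm]
  · rintro ⟨V, S⟩ h
    simp only [Finset.mem_sigma, Finset.mem_powerset] at h ⊢
    rw [Finset.union_sdiff_of_subset h.2]
  · rintro ⟨S, T⟩ h
    simp only [Finset.mem_sigma, Finset.mem_powerset, Finset.subset_sdiff] at h ⊢
    rw [Finset.union_sdiff_cancel_left h.2.2.symm, sdiff_sdiff_left]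
    rfl

end Splittings

/-! ### Koszul signs -/

section Signs

variable (K : Type v) [Field K]

/-- The sign `(-1)^a` as an element of `K`. -/
def parSign (a : ℤ) : K := ((a.negOnePow : ℤ) : K)

theorem parSign_add (a b : ℤ) : parSign K (a + b) = parSign K a * parSign K b := by
  simp [parSign, Int.negOnePow_add]

@[simp] theorem parSign_zero : parSign K 0 = 1 := by simp [parSign]

@[simp] theorem parSign_one : parSign K 1 = -1 := by simp [parSign]

theorem parSign_mul_self (a : ℤ) : parSign K a * parSign K a = 1 := by
  rw [← parSign_add, ← two_mul]
  simp [parSign, Int.negOnePow_two_mul]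

theorem negOnePow_smul_eq {N : Type*} [AddCommGroup N] [Module K N] (a : ℤ) (x : N) :
    a.negOnePow • x = parSign K a • x := by
  rw [Units.smul_def, parSign, Int.cast_smul_eq_zsmul]

variable {n : ℕ} (d : Fin n → ℤ)

/-- The Koszul sign of the rearrangement which lists `S` before `T`, for disjoint sets `S`, `T` of
indices of homogeneous elements of degrees `d i`; as an element of `K`. -/
def listSign (S T : Finset (Fin n)) : K :=
  ∏ i ∈ S, ∏ j ∈ T, if j < i then parSign K (d j * d i) else 1

theorem koszulSign_smul_eq {α : Type*} [LinearOrder α] (c : Fin n → α) {N : Type*}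
    [AddCommGroup N] [Module K N] (x : N) :
    koszulSign d c • x =
      (∏ i, ∏ j, if i < j ∧ c j < c i then parSign K (d i * d j) else 1) • x := by
  rw [Units.smul_def, ← Int.cast_smul_eq_zsmul K]
  congr 1
  simp only [koszulSign, Units.coe_prod, Int.cast_prod]
  refine Finset.prod_congr rfl fun i _ => Finset.prod_congr rfl fun j _ => ?_
  split_ifs <;> simp [parSign]

theorem koszulSign_unshuffle_smul (A : Finset (Fin n)) {N : Type*}
    [AddCommGroup N] [Module K N] (x : N) :
    koszulSign d (unshuffle A) • x = listSign K d A Aᶜ • x := by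
  rw [koszulSign_smul_eq K]
  congr 1
  rw [Finset.prod_comm, listSign, ← Finset.prod_mul_prod_compl A]
  rw [Finset.prod_eq_one (s := Aᶜ), mul_one]
  · refine Finset.prod_congr rfl fun j hj => ?_
    rw [← Finset.prod_mul_prod_compl A, Finset.prod_eq_one (s := A), one_mul]
    · refine Finset.prod_congr rfl fun i hi => ?_
      simp [unshuffle, hj, Finset.mem_compl.1 hi]
    · intro i hi
      simp [unshuffle, hi]
  · intro j hj
    refine Finset.prod_eq_one fun i _ => ?_
    rw [if_neg]
    rintro ⟨-, h⟩
    simp only [unshuffle, Finset.mem_compl.1 hj, if_false] at h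
    split_ifs at h <;> simp at h

theorem listSign_union_left {S T : Finset (Fin n)} (h : Disjoint S T) (U : Finset (Fin n)) :
    listSign K d (S ∪ T) U = listSign K d S U * listSign K d T U :=
  Finset.prod_union h

theorem listSign_union_right {T U : Finset (Fin n)} (h : Disjoint T U) (S : Finset (Fin n)) :
    listSign K d S (T ∪ U) = listSign K d S T * listSign K d S U := by
  simp only [listSign, Finset.prod_union h, Finset.prod_mul_distrib]

@[simp] theorem listSign_empty_right (S : Finset (Fin n)) : listSign K d S ∅ = 1 := by
  simp [listSign]

theorem listSign_map {m : ℕ} (e : Fin m ↪o Fin n) (S T : Finset (Fin m)) :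
    listSign K d (S.map e.toEmbedding) (T.map e.toEmbedding) = listSign K (d ∘ e) S T := by
  simp [listSign, Finset.prod_map]

theorem parSign_sum_mul_sum (S T : Finset (Fin n)) :
    parSign K ((∑ i ∈ S, d i) * ∑ j ∈ T, d j) = ∏ i ∈ S, ∏ j ∈ T, parSign K (d i * d j) := by
  have key : ∀ (U : Finset (Fin n)) (f : Fin n → ℤ),
      parSign K (∑ i ∈ U, f i) = ∏ i ∈ U, parSign K (f i) := by
    intro U f
    induction U using Finset.induction_on with
    | empty => simp
    | insert a U ha ih => rw [Finset.sum_insert ha, Finset.prod_insert ha, parSign_add, ih]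
  simp only [Finset.sum_mul_sum, key]

theorem listSign_swap {S T : Finset (Fin n)} (h : Disjoint S T) :
    listSign K d T S =
      parSign K ((∑ i ∈ S, d i) * ∑ j ∈ T, d j) * listSign K d S T := by
  rw [parSign_sum_mul_sum, listSign, listSign, Finset.prod_comm, ← Finset.prod_mul_distrib]
  refine Finset.prod_congr rfl fun i hi => ?_
  rw [← Finset.prod_mul_distrib]
  refine Finset.prod_congr rfl fun j hj => ?_
  have hij : i ≠ j := fun e => Finset.disjoint_left.1 h hi (e ▸ hj)
  rcases lt_or_gt_of_ne hij with h1 | h1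
  · simp [h1, h1.not_gt]
  · simp [h1, h1.not_gt, mul_comm (d j), parSign_mul_self]

/-- The Koszul sign of the rearrangement of the `v (σ i)`, `i ∈ B`, from the order of the `σ i` to
the order of the `i`. -/
def permSign (σ : Equiv.Perm (Fin n)) (B : Finset (Fin n)) : K :=
  ∏ i ∈ B, ∏ j ∈ B, if σ i < σ j ∧ j < i then parSign K (d (σ i) * d (σ j)) else 1

/-- An inversion of `σ` between `S` and `T` is a pair which is counted by exactly one of the signs
that list `S` before `T`, the one for the `σ i` or the one for the `i`. -/
theorem permSign_mul_listSign (σ : Equiv.Perm (Fin n)) {S T : Finset (Fin n)}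
    (h : Disjoint S T) :
    listSign K d (S.map σ.toEmbedding) (T.map σ.toEmbedding) * permSign K d σ S *
      permSign K d σ T = permSign K d σ (S ∪ T) * listSign K (d ∘ σ) S T := by
  have e : listSign K d (S.map σ.toEmbedding) (T.map σ.toEmbedding) =
      (∏ i ∈ S, ∏ j ∈ T, if σ i < σ j ∧ j < i then parSign K (d (σ i) * d (σ j)) else 1) *
      (∏ i ∈ T, ∏ j ∈ S, if σ i < σ j ∧ j < i then parSign K (d (σ i) * d (σ j)) else 1) *
      listSign K (d ∘ σ) S T := by
    rw [Finset.prod_comm (s := T), listSign, listSign, Finset.prod_map,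
      ← Finset.prod_mul_distrib, ← Finset.prod_mul_distrib]
    refine Finset.prod_congr rfl fun i hi => ?_
    rw [Finset.prod_map, ← Finset.prod_mul_distrib, ← Finset.prod_mul_distrib]
    refine Finset.prod_congr rfl fun j hj => ?_
    have hij : i ≠ j := fun e => Finset.disjoint_left.1 h hi (e ▸ hj)
    have hs : σ i ≠ σ j := fun e => hij (σ.injective e)
    rcases lt_or_gt_of_ne hij with h1 | h1 <;> rcases lt_or_gt_of_ne hs with h2 | h2 <;>
      simp [h1, h1.not_gt, h2, h2.not_gt, mul_comm (d (σ j)), parSign_mul_self]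
  rw [e]
  simp only [permSign, Finset.prod_union h, Finset.prod_mul_distrib]
  ring

theorem koszulSign_perm_smul (σ : Equiv.Perm (Fin n)) {N : Type*}
    [AddCommGroup N] [Module K N] (x : N) :
    koszulSign d (⇑σ.symm) • x = permSign K d σ Finset.univ • x := by
  rw [koszulSign_smul_eq K]
  congr 1
  rw [permSign, ← Equiv.prod_comp σ]
  refine Finset.prod_congr rfl fun i _ => ?_
  rw [← Equiv.prod_comp σ]
  simp

end Signs

/-! ### Multilinear maps on subsequences -/

section Subsequences

variable {K : Type v} [Field K] {V : Type*} [AddCommGroup V] [Module K V] {N : Type*}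
  [AddCommGroup N] [Module K N] (f : ∀ n : ℕ, MultilinearMap K (fun _ : Fin n => V) N)

/-- The value of a sequence `f₁, f₂, …` of multilinear maps on the subsequence `v_S`. -/
def onSubset {n : ℕ} (v : Fin n → V) (S : Finset (Fin n)) : N := f S.card (subTuple v S)

/-- The value on `v_S` may be computed with any increasing enumeration of `S`, whatever natural
number is used for its cardinality. -/
theorem onSubset_eq_of_orderEmb {m n : ℕ} (e : Fin m ↪o Fin n) (v : Fin n → V)
    {S : Finset (Fin n)} (hS : Finset.univ.map e.toEmbedding = S) :
    onSubset f v S = f m (v ∘ e) := by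
  have hm : S.card = m := by rw [← hS, Finset.card_map, Finset.card_univ, Fintype.card_fin]
  subst hm
  have he : e = S.orderEmbOfFin rfl :=
    Finset.orderEmbOfFin_unique' rfl fun i =>
      hS.subset (Finset.mem_map_of_mem e.toEmbedding (Finset.mem_univ i))
  rw [he]
  rfl

theorem onSubset_univ {n : ℕ} (v : Fin n → V) : onSubset f v Finset.univ = f n v :=
  onSubset_eq_of_orderEmb f (RelEmbedding.refl _) v (by ext; simp)

theorem onSubset_empty (hf : f 0 = 0) {n : ℕ} (v : Fin n → V) : onSubset f v ∅ = 0 := by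
  exact congrArg (fun g : MultilinearMap K (fun _ : Fin 0 => V) N => g (subTuple v ∅)) hf

theorem univ_map_orderEmbOfFin {n : ℕ} (S : Finset (Fin n)) :
    Finset.univ.map (S.orderEmbOfFin rfl).toEmbedding = S := by
  simp

theorem onSubset_comp {m n : ℕ} (e : Fin m ↪o Fin n) (v : Fin n → V) (S : Finset (Fin m)) :
    onSubset f (v ∘ e) S = onSubset f v (S.map e.toEmbedding) := by
  symm
  refine onSubset_eq_of_orderEmb f ((S.orderEmbOfFin rfl).trans e) v ?_
  conv_rhs => rw [← univ_map_orderEmbOfFin S, Finset.map_map]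
  rfl

/-- The map `Fin (k + 1) → Fin (n + 1)` which fixes `0` and is `e` on the successors. -/
def succOrderEmb {k n : ℕ} (e : Fin k ↪o Fin n) : Fin (k + 1) ↪o Fin (n + 1) :=
  OrderEmbedding.ofStrictMono (Fin.cons 0 fun i => (e i).succ) (by
    intro i j hij
    induction i using Fin.cases with
    | zero =>
      induction j using Fin.cases with
      | zero => exact absurd hij (lt_irrefl _)
      | succ j => simp
    | succ i =>
      induction j using Fin.cases with
      | zero => exact absurd hij (Fin.not_lt_zero _)
      | succ j => simpa using hij)

theorem succOrderEmb_zero {k n : ℕ} (e : Fin k ↪o Fin n) : succOrderEmb e 0 = 0 := rfl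

theorem succOrderEmb_succ {k n : ℕ} (e : Fin k ↪o Fin n) (i : Fin k) :
    succOrderEmb e i.succ = (e i).succ := rfl

/-- The tuple `x, v_S` is the subsequence of `x, v₁, …, vₙ` with indices in `{0} ∪ (S + 1)`. -/
theorem onSubset_cons {n : ℕ} (x : V) (v : Fin n → V) (S : Finset (Fin n)) :
    onSubset f (Fin.cons x v : Fin (n + 1) → V)
        (insert 0 (S.map (Fin.succOrderEmb n).toEmbedding)) =
      f (S.card + 1) (Fin.cons x (subTuple v S)) := by
  rw [onSubset_eq_of_orderEmb f (succOrderEmb (S.orderEmbOfFin rfl))]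
  · congr 1
    ext i
    induction i using Fin.cases with
    | zero => rw [Function.comp_apply, succOrderEmb_zero, Fin.cons_zero, Fin.cons_zero]
    | succ i =>
      rw [Function.comp_apply, succOrderEmb_succ, Fin.cons_succ, Fin.cons_succ]
      rfl
  · ext j
    have hmem : ∀ k, k ∈ S ↔ ∃ i, S.orderEmbOfFin rfl i = k := fun k => by
      rw [← Set.mem_range, Finset.range_orderEmbOfFin, Finset.mem_coe]
    simp only [Finset.mem_map, Finset.mem_univ, true_and, RelEmbedding.coe_toEmbedding,
      Fin.exists_fin_succ, succOrderEmb_zero, succOrderEmb_succ, Finset.mem_insert, hmem,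
      exists_exists_eq_and, Fin.coe_succOrderEmb, eq_comm (a := j)]

theorem onSubset_map_succ {n : ℕ} (x : V) (v : Fin n → V) (S : Finset (Fin n)) :
    onSubset f (Fin.cons x v : Fin (n + 1) → V) (S.map (Fin.succOrderEmb n).toEmbedding) =
      onSubset f v S := by
  rw [← onSubset_comp]
  rfl

end Subsequences

namespace TransferData

section Eval

variable {K : Type v} [Field K]

theorem pair_apply {U : Type u} [AddCommGroup U] [Module K U] {N : Type w} [AddCommGroup N]
    [Module K N] (β : N →ₗ[K] N →ₗ[K] N) {n : ℕ} (S : Finset (Fin n))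
    (a : MultilinearMap K (fun _ : Fin S.card => U) N)
    (b : MultilinearMap K (fun _ : Fin Sᶜ.card => U) N) (v : Fin n → U) :
    pair β S a b v = β (a (subTuple v S)) (b (subTuple v Sᶜ)) := by
  simp only [pair, MultilinearMap.domDomCongr_apply, LinearMap.compMultilinearMap_apply,
    MultilinearMap.domCoprod_apply, TensorProduct.lift.tmul, finSumEquivOfFinset_inl,
    finSumEquivOfFinset_inr]
  rfl

/-- On homogeneous elements, only the summand of `withSign` in which `p` is the family of parities
of the degrees survives. -/
theorem withSign_apply (U : GradedSpace.{u} K) {n : ℕ} (S : Finset (Fin n)) {N : Type w}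
    [AddCommGroup N] [Module K N] (g : MultilinearMap K (fun _ : Fin n => U.carrier) N)
    {d : Fin n → ℤ} {v : Fin n → U} (hv : IsHomogeneousTuple U d v) :
    withSign U S g v = listSign K d S Sᶜ • g v := by
  have hp : ∀ i, ∃ a : Fin 2, d i % 2 = (a : ℤ) := fun i => by
    rcases Int.emod_two_eq_zero_or_one (d i) with h | h
    · exact ⟨0, by simp [h]⟩
    · exact ⟨1, by simp [h]⟩
  choose p hp using hp
  have hpar : ∀ i j, parSign K ((((p i : ℕ) : ℤ)) * ((p j : ℕ) : ℤ)) = parSign K (d i * d j) := by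
    intro i j
    have h1 := hp i
    have h2 := hp j
    have hmod : (((p i : ℕ) : ℤ)) * ((p j : ℕ) : ℤ) ≡ d i * d j [ZMOD 2] := by
      apply Int.ModEq.mul
      · rw [Int.ModEq, ← h1, Int.emod_emod]
      · rw [Int.ModEq, ← h2, Int.emod_emod]
    unfold parSign
    congr 2
    rw [Int.negOnePow_eq_iff]
    exact even_iff_two_dvd.2 hmod.symm.dvd
  rw [withSign, sum_apply, Finset.sum_eq_single p]
  · rw [smul_apply, koszulSign_unshuffle_smul K]
    congr 1
    · simp only [listSign, hpar]
    · rw [MultilinearMap.compLinearMap_apply]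
      congr 1
      ext i
      rw [U.parityPart_of_mem (hv i), if_pos (hp i)]
  · intro q _ hq
    obtain ⟨i, hi⟩ := Function.ne_iff.1 hq
    rw [smul_apply, MultilinearMap.compLinearMap_apply,
      MultilinearMap.map_coord_zero _ i, smul_zero]
    rw [U.parityPart_of_mem (hv i), if_neg]
    intro h
    rw [hp i] at h
    exact hi (Fin.ext (by exact_mod_cast h.symm))
  · intro h; exact absurd (Finset.mem_univ p) h

end Eval

variable {K : Type v} [Field K] {A : DGLA.{w} K} {C : DGSpace.{u} K} (T : TransferData A C)

/-- The quadratic expression `½ ∑_S ε(S) q₂(ι_∞(v_S), ι_∞(v_{B ∖ S}))`, the sum being over all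
subsets `S` of `B`; those with `S = ∅` or `S = B` contribute `0`. -/
noncomputable def quad {n : ℕ} (d : Fin n → ℤ) (v : Fin n → C.carrier) (B : Finset (Fin n)) :
    A.carrier :=
  (2⁻¹ : K) • ∑ S ∈ B.powerset, listSign K d S (B \ S) •
    A.q₂ (onSubset T.ιInfty v S) (onSubset T.ιInfty v (B \ S))

/-- The term `vᵢ` if `B = {i}`, and `0` if `B` is not a singleton. -/
noncomputable def linTerm {n : ℕ} (v : Fin n → C.carrier) (B : Finset (Fin n)) : C.carrier :=
  ∑ i ∈ B, if B = {i} then v i else 0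

theorem ιInfty_zero : T.ιInfty 0 = 0 := by rw [ιInfty]

theorem quad_comp {m n : ℕ} (e : Fin m ↪o Fin n) (d : Fin n → ℤ) (v : Fin n → C.carrier)
    (B : Finset (Fin m)) : T.quad (d ∘ e) (v ∘ e) B = T.quad d v (B.map e.toEmbedding) := by
  rw [quad, quad, Finset.sum_powerset_map]
  simp only [onSubset_comp, ← Finset.map_sdiff, listSign_map]

theorem linTerm_comp {m n : ℕ} (e : Fin m ↪ Fin n) (v : Fin n → C.carrier)
    (B : Finset (Fin m)) : linTerm (v ∘ e) B = linTerm v (B.map e) := by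
  rw [linTerm, linTerm, Finset.sum_map]
  refine Finset.sum_congr rfl fun i _ => ?_
  rw [← Finset.map_singleton]
  simp only [Finset.map_inj, Function.comp_apply]

theorem linTerm_singleton {n : ℕ} (v : Fin n → C.carrier) (i : Fin n) : linTerm v {i} = v i := by
  simp [linTerm]

theorem linTerm_of_card_ne {n : ℕ} (v : Fin n → C.carrier) {B : Finset (Fin n)}
    (h : B.card ≠ 1) : linTerm v B = 0 := by
  refine Finset.sum_eq_zero fun i _ => if_neg ?_
  rintro rfl
  simp at h

theorem quad_of_card_le_one {n : ℕ} (d : Fin n → ℤ) (v : Fin n → C.carrier)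
    {B : Finset (Fin n)} (h : B.card ≤ 1) : T.quad d v B = 0 := by
  rw [quad, Finset.sum_eq_zero, smul_zero]
  intro S hS
  have hc := Finset.card_sdiff_add_card_eq_card (Finset.mem_powerset.1 hS)
  have : S = ∅ ∨ B \ S = ∅ := by
    simp only [← Finset.card_eq_zero]
    omega
  rcases this with h | h <;> rw [h, onSubset_empty _ T.ιInfty_zero] <;> simp

/-- The sum over the nonempty proper subsets in the recursive definitions is `quad`. -/
theorem sum_proper_eq {n : ℕ} {d : Fin n → ℤ} {v : Fin n → C.carrier}
    (hv : IsHomogeneousTuple (C.shift 1) d v) :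
    ((2⁻¹ : K) • ∑ S : {S : Finset (Fin n) // S.Nonempty ∧ Sᶜ.Nonempty},
      withSign (C.shift 1) S.1 (pair A.q₂ S.1 (T.ιInfty S.1.card) (T.ιInfty S.1ᶜ.card))) v =
      T.quad d v Finset.univ := by
  rw [quad, smul_apply, sum_apply, Finset.powerset_univ]
  congr 1
  have e : ∀ S : Finset (Fin n),
      withSign (C.shift 1) S (pair A.q₂ S (T.ιInfty S.card) (T.ιInfty Sᶜ.card)) v =
        listSign K d S (Finset.univ \ S) •
          A.q₂ (onSubset T.ιInfty v S) (onSubset T.ιInfty v (Finset.univ \ S)) := by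
    intro S
    rw [withSign_apply _ _ _ hv, pair_apply, ← Finset.compl_eq_univ_sdiff]
    rfl
  simp only [e]
  rw [← Finset.sum_subtype (Finset.univ.filter fun S : Finset (Fin n) =>
    S.Nonempty ∧ Sᶜ.Nonempty) (by simp) (fun S => listSign K d S (Finset.univ \ S) •
          A.q₂ (onSubset T.ιInfty v S) (onSubset T.ιInfty v (Finset.univ \ S)))]
  refine Finset.sum_subset (Finset.subset_univ _) fun S _ hS => ?_
  rw [Finset.mem_filter, not_and, not_and_or, Finset.not_nonempty_iff_eq_empty,
    Finset.not_nonempty_iff_eq_empty, Finset.compl_eq_univ_sdiff] at hS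
  rcases hS (Finset.mem_univ _) with h | h <;> rw [h, onSubset_empty _ T.ιInfty_zero] <;> simp

theorem ιInfty_apply {n : ℕ} {d : Fin n → ℤ} {v : Fin n → C.carrier}
    (hv : IsHomogeneousTuple (C.shift 1) d v) :
    T.ιInfty n v = T.ι (linTerm v Finset.univ) + T.h (T.quad d v Finset.univ) := by
  rcases n with _ | _ | n
  · rw [T.quad_of_card_le_one _ _ (by simp), linTerm_of_card_ne _ (by simp), ιInfty_zero]
    simp
  · rw [T.quad_of_card_le_one _ _ (by simp),
      show (Finset.univ : Finset (Fin (0 + 1))) = {0} from rfl, linTerm_singleton, map_zero,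
      add_zero, ιInfty]
    rfl
  · rw [linTerm_of_card_ne _ (by simp), ← T.sum_proper_eq hv, map_zero, zero_add, ιInfty]
    rfl

theorem bracket_apply {n : ℕ} {d : Fin n → ℤ} {v : Fin n → C.carrier}
    (hv : IsHomogeneousTuple (C.shift 1) d v) :
    T.bracket n v = -C.d (linTerm v Finset.univ) + T.π (T.quad d v Finset.univ) := by
  rcases n with _ | _ | n
  · rw [T.quad_of_card_le_one _ _ (by simp), linTerm_of_card_ne _ (by simp)]
    simp [bracket]
  · rw [T.quad_of_card_le_one _ _ (by simp),
      show (Finset.univ : Finset (Fin (0 + 1))) = {0} from rfl, linTerm_singleton, map_zero,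
      add_zero]
    rfl
  · rw [linTerm_of_card_ne _ (by simp), ← T.sum_proper_eq hv, map_zero, neg_zero, zero_add]
    rfl

theorem onSubset_ιInfty {n : ℕ} {d : Fin n → ℤ} {v : Fin n → C.carrier}
    (hv : IsHomogeneousTuple (C.shift 1) d v) (B : Finset (Fin n)) :
    onSubset T.ιInfty v B = T.ι (linTerm v B) + T.h (T.quad d v B) := by
  have h := T.ιInfty_apply (d := d ∘ B.orderEmbOfFin rfl) (v := v ∘ B.orderEmbOfFin rfl)
    fun i => hv _
  rw [T.quad_comp, univ_map_orderEmbOfFin] at h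
  have h' := linTerm_comp (B.orderEmbOfFin rfl).toEmbedding v Finset.univ
  rw [univ_map_orderEmbOfFin] at h'
  rw [← h']
  exact h

theorem onSubset_bracket {n : ℕ} {d : Fin n → ℤ} {v : Fin n → C.carrier}
    (hv : IsHomogeneousTuple (C.shift 1) d v) (B : Finset (Fin n)) :
    onSubset T.bracket v B = -C.d (linTerm v B) + T.π (T.quad d v B) := by
  have h := T.bracket_apply (d := d ∘ B.orderEmbOfFin rfl) (v := v ∘ B.orderEmbOfFin rfl)
    fun i => hv _
  rw [T.quad_comp, univ_map_orderEmbOfFin] at h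
  have h' := linTerm_comp (B.orderEmbOfFin rfl).toEmbedding v Finset.univ
  rw [univ_map_orderEmbOfFin] at h'
  rw [← h']
  exact h

end TransferData

/-! ### A differential graded Lie algebra in shifted degrees -/

namespace DGLA

variable {K : Type v} [Field K] (A : DGLA.{w} K) {a b c : ℤ} {x y z : A.carrier}

theorem q₁_mem (hx : x ∈ A.deg (1 + a)) : A.q₁ x ∈ A.deg (1 + (a + 1)) := by
  have := A.d_mem _ x hx
  rw [add_assoc] at this
  exact neg_mem this

theorem q₂_eq (hx : x ∈ A.deg (1 + a)) (y : A.carrier) :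
    A.q₂ x y = -(parSign K a • A.br x y) := by
  rw [q₂, LinearMap.comp_apply, A.sgn_of_mem hx, negOnePow_smul_eq K, parSign_add, parSign_one,
    neg_one_mul, neg_smul, map_neg, LinearMap.neg_apply, map_smul, LinearMap.smul_apply]

theorem q₂_mem (hx : x ∈ A.deg (1 + a)) (hy : y ∈ A.deg (1 + b)) :
    A.q₂ x y ∈ A.deg (1 + (a + b + 1)) := by
  rw [A.q₂_eq hx]
  have := A.br_mem _ _ x hx y hy
  rw [show 1 + a + (1 + b) = 1 + (a + b + 1) by ring] at this
  exact neg_mem (Submodule.smul_mem _ _ this)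

theorem q₂_symm (hx : x ∈ A.deg (1 + a)) (hy : y ∈ A.deg (1 + b)) :
    A.q₂ x y = parSign K (a * b) • A.q₂ y x := by
  rw [A.q₂_eq hx, A.q₂_eq hy, A.skew _ _ x hx y hy, negOnePow_smul_eq K,
    show (1 + a) * (1 + b) = 1 + a + b + a * b by ring]
  simp only [parSign_add, parSign_one, smul_neg, smul_smul]
  match_scalars
  grind [parSign_mul_self]

theorem q₁_q₂ (hx : x ∈ A.deg (1 + a)) (y : A.carrier) (hy : y ∈ A.deg (1 + b)) :
    A.q₁ (A.q₂ x y) = -(A.q₂ (A.q₁ x) y + parSign K a • A.q₂ x (A.q₁ y)) := by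
  rw [A.q₂_eq hx, A.q₂_eq hx, A.q₂_eq (A.q₁_mem hx)]
  simp only [q₁, LinearMap.neg_apply, map_neg, map_smul, A.leibniz _ _ x hx y hy,
    negOnePow_smul_eq K, parSign_add, parSign_one, neg_neg, smul_neg, smul_add, smul_smul]
  module

/-- The Jacobi identity, as a relation between the three ways of applying `q₂` twice. -/
theorem q₂_jacobi (hx : x ∈ A.deg (1 + a)) (hy : y ∈ A.deg (1 + b)) (hz : z ∈ A.deg (1 + c)) :
    A.q₂ (A.q₂ x y) z + parSign K (b * c) • A.q₂ (A.q₂ x z) y +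
      parSign K (a * (b + c)) • A.q₂ (A.q₂ y z) x = 0 := by
  have hyz := A.q₂_mem hy hz
  have hxz := A.q₂_mem hx hz
  rw [A.q₂_eq (A.q₂_mem hx hy), A.q₂_eq hxz, A.q₂_eq hyz, A.q₂_eq hx, A.q₂_eq hx, A.q₂_eq hy]
  have hbyz := A.br_mem _ _ y hy z hz
  have hbxz := A.br_mem _ _ x hx z hz
  simp only [map_neg, map_smul, LinearMap.neg_apply, LinearMap.smul_apply]
  rw [A.skew _ _ _ hbyz x hx, A.skew _ _ _ hbxz y hy, A.jacobi _ _ _ x hx y hy z hz]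
  simp only [negOnePow_smul_eq K]
  rw [show (1 + a) * (1 + b) = 1 + a + b + a * b by ring,
    show (1 + b + (1 + c)) * (1 + a) = 1 + 1 + (b + c) + (1 + 1) * a + a * b + a * c by ring,
    show (1 + a + (1 + c)) * (1 + b) = 1 + 1 + (a + c) + (1 + 1) * b + a * b + b * c by ring,
    show a * (b + c) = a * b + a * c by ring]
  simp only [add_mul (1 : ℤ), one_mul, parSign_add, parSign_one]
  have ha := parSign_mul_self K a
  have hb := parSign_mul_self K b
  have hc := parSign_mul_self K c
  have hab := parSign_mul_self K (a * b)
  have hac := parSign_mul_self K (a * c)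
  have hbc := parSign_mul_self K (b * c)
  match_scalars
  · grind
  · grind

end DGLA

/-! ### Sums over splittings into three parts -/

section ThreeParts

variable {ι : Type*} [DecidableEq ι] {N : Type*} [AddCommMonoid N]

/-- The sum of `f S T U` over all splittings of `B` into three parts `S`, `T`, `U`. -/
def sumSplit₃ (B : Finset ι) (f : Finset ι → Finset ι → Finset ι → N) : N :=
  ∑ S ∈ B.powerset, ∑ T ∈ (B \ S).powerset, f S T ((B \ S) \ T)

theorem sumSplit₃_eq (B : Finset ι) (f : Finset ι → Finset ι → Finset ι → N) :
    sumSplit₃ B f = ∑ V ∈ B.powerset, ∑ S ∈ V.powerset, f S (V \ S) (B \ V) :=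
  Finset.sum_powerset_sdiff_assoc B f

theorem sumSplit₃_swap_right (B : Finset ι) (f : Finset ι → Finset ι → Finset ι → N) :
    sumSplit₃ B (fun S T U => f S U T) = sumSplit₃ B f :=
  Finset.sum_congr rfl fun S _ =>
    (Finset.sum_powerset_sdiff_comm (B \ S) fun T U => f S T U).symm

theorem sumSplit₃_swap_left (B : Finset ι) (f : Finset ι → Finset ι → Finset ι → N) :
    sumSplit₃ B (fun S T U => f T S U) = sumSplit₃ B f := by
  rw [sumSplit₃_eq, sumSplit₃_eq]
  exact Finset.sum_congr rfl fun V _ =>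
    (Finset.sum_powerset_sdiff_comm V fun S T => f S T (B \ V)).symm

theorem sumSplit₃_congr (B : Finset ι) {f g : Finset ι → Finset ι → Finset ι → N}
    (h : ∀ S T U, Disjoint S T → Disjoint S U → Disjoint T U → f S T U = g S T U) :
    sumSplit₃ B f = sumSplit₃ B g := by
  refine Finset.sum_congr rfl fun S _ => Finset.sum_congr rfl fun T hT => h _ _ _ ?_ ?_ ?_
  · exact (Finset.subset_sdiff.1 (Finset.mem_powerset.1 hT)).2.symm
  · exact Finset.disjoint_sdiff.mono_right Finset.sdiff_subset
  · exact Finset.disjoint_sdiff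

end ThreeParts

/-! ### The components of the transferred structure -/

namespace TransferData

variable {K : Type v} [Field K] {A : DGLA.{w} K} {C : DGSpace.{u} K} (T : TransferData A C)

section Degrees

variable {n : ℕ} {d : Fin n → ℤ} {v : Fin n → C.carrier}

theorem linTerm_mem (hv : IsHomogeneousTuple (C.shift 1) d v) (B : Finset (Fin n)) :
    linTerm v B ∈ C.deg (1 + ∑ i ∈ B, d i) := by
  refine Submodule.sum_mem _ fun i _ => ?_
  split_ifs with h
  · rw [h, Finset.sum_singleton]; exact hv i
  · exact zero_mem _

theorem quad_mem_of_forall_ssubset (B : Finset (Fin n))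
    (h : ∀ S ⊂ B, onSubset T.ιInfty v S ∈ A.deg (1 + ∑ i ∈ S, d i)) :
    T.quad d v B ∈ A.deg (1 + (∑ i ∈ B, d i + 1)) := by
  refine Submodule.smul_mem _ _ (Submodule.sum_mem _ fun S hS => Submodule.smul_mem _ _ ?_)
  rw [Finset.mem_powerset] at hS
  rcases S.eq_empty_or_nonempty with rfl | hne
  · rw [onSubset_empty _ T.ιInfty_zero, map_zero]; exact zero_mem _
  rcases hS.eq_or_ssubset with rfl | hss
  · rw [Finset.sdiff_self, onSubset_empty _ T.ιInfty_zero, map_zero]; exact zero_mem _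
  · rw [← Finset.sum_sdiff hS, add_comm (∑ i ∈ B \ S, d i)]
    exact A.q₂_mem (h S hss) (h _ (Finset.sdiff_ssubset hS hne))

theorem onSubset_ιInfty_mem (hv : IsHomogeneousTuple (C.shift 1) d v) (B : Finset (Fin n)) :
    onSubset T.ιInfty v B ∈ A.deg (1 + ∑ i ∈ B, d i) := by
  induction B using Finset.strongInduction with
  | H B ih =>
    rw [T.onSubset_ιInfty hv]
    refine add_mem (T.ι_mem _ _ (linTerm_mem hv B)) ?_
    have := T.h_mem _ _ (T.quad_mem_of_forall_ssubset B ih)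
    rwa [← add_assoc, add_sub_cancel_right] at this

theorem quad_mem (hv : IsHomogeneousTuple (C.shift 1) d v) (B : Finset (Fin n)) :
    T.quad d v B ∈ A.deg (1 + (∑ i ∈ B, d i + 1)) :=
  T.quad_mem_of_forall_ssubset B fun S _ => T.onSubset_ιInfty_mem hv S

theorem onSubset_bracket_mem (hv : IsHomogeneousTuple (C.shift 1) d v) (B : Finset (Fin n)) :
    onSubset T.bracket v B ∈ C.deg (1 + (∑ i ∈ B, d i + 1)) := by
  rw [T.onSubset_bracket hv]
  refine add_mem (neg_mem ?_) (T.π_mem _ _ (T.quad_mem hv B))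
  have := C.d_mem _ _ (linTerm_mem hv B)
  rwa [add_assoc] at this

end Degrees

section Symmetry

variable {n : ℕ} {d : Fin n → ℤ} {v : Fin n → C.carrier}

theorem quad_perm_of_forall_ssubset (σ : Equiv.Perm (Fin n)) (B : Finset (Fin n))
    (h : ∀ S ⊂ B, onSubset T.ιInfty v (S.map σ.toEmbedding) =
      permSign K d σ S • onSubset T.ιInfty (v ∘ σ) S) :
    T.quad d v (B.map σ.toEmbedding) = permSign K d σ B • T.quad (d ∘ σ) (v ∘ σ) B := by
  rw [quad, quad, Finset.sum_powerset_map,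
    smul_comm (permSign K d σ B), Finset.smul_sum (r := permSign K d σ B)]
  refine congrArg (fun y : A.carrier => (2⁻¹ : K) • y) (Finset.sum_congr rfl fun S hS => ?_)
  rw [Finset.mem_powerset] at hS
  rw [← Finset.map_sdiff]
  have h0 : onSubset T.ιInfty v (Finset.map σ.toEmbedding ∅) = 0 := by
    rw [Finset.map_empty, onSubset_empty _ T.ιInfty_zero]
  rcases S.eq_empty_or_nonempty with rfl | hne
  · rw [h0, onSubset_empty _ T.ιInfty_zero]; simp
  rcases hS.eq_or_ssubset with rfl | hss
  · rw [Finset.sdiff_self, h0, onSubset_empty _ T.ιInfty_zero]; simp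
  · rw [h S hss, h _ (Finset.sdiff_ssubset hS hne)]
    simp only [map_smul, LinearMap.smul_apply, smul_smul]
    congr 1
    have := permSign_mul_listSign K d σ (S := S) (T := B \ S) Finset.disjoint_sdiff
    rw [Finset.union_sdiff_of_subset hS] at this
    linear_combination this

theorem linTerm_perm (σ : Equiv.Perm (Fin n)) (B : Finset (Fin n)) :
    linTerm v (B.map σ.toEmbedding) = permSign K d σ B • linTerm (v ∘ σ) B := by
  have h := linTerm_comp σ.toEmbedding v B
  rw [← h]
  by_cases hB : B.card = 1
  · obtain ⟨i, rfl⟩ := Finset.card_eq_one.1 hB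
    simp [permSign]
  · change linTerm (v ∘ σ) B = _
    rw [linTerm_of_card_ne _ hB, smul_zero]

theorem onSubset_ιInfty_perm (hv : IsHomogeneousTuple (C.shift 1) d v)
    (σ : Equiv.Perm (Fin n)) (B : Finset (Fin n)) :
    onSubset T.ιInfty v (B.map σ.toEmbedding) =
      permSign K d σ B • onSubset T.ιInfty (v ∘ σ) B := by
  induction B using Finset.strongInduction with
  | H B ih =>
    rw [T.onSubset_ιInfty hv, T.onSubset_ιInfty (d := d ∘ σ) (v := v ∘ σ) fun i => hv (σ i),
      T.quad_perm_of_forall_ssubset σ B ih, linTerm_perm (d := d), map_smul, map_smul, smul_add]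

theorem onSubset_bracket_perm (hv : IsHomogeneousTuple (C.shift 1) d v)
    (σ : Equiv.Perm (Fin n)) (B : Finset (Fin n)) :
    onSubset T.bracket v (B.map σ.toEmbedding) =
      permSign K d σ B • onSubset T.bracket (v ∘ σ) B := by
  rw [T.onSubset_bracket hv, T.onSubset_bracket (d := d ∘ σ) (v := v ∘ σ) fun i => hv (σ i),
    T.quad_perm_of_forall_ssubset σ B fun S _ => T.onSubset_ιInfty_perm hv σ S,
    linTerm_perm (d := d), map_smul, map_smul, smul_add, smul_neg]

end Symmetry

theorem isSymHom_bracket (n : ℕ) : IsSymHom (C.shift 1) (C.shift 1) 1 (T.bracket n) where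
  map_mem d v hv := by
    have := T.onSubset_bracket_mem hv Finset.univ
    rwa [onSubset_univ] at this
  symm d v hv σ := by
    have := T.onSubset_bracket_perm hv σ Finset.univ
    rwa [Finset.map_univ_equiv, onSubset_univ, onSubset_univ,
      ← koszulSign_perm_smul] at this

/-! ### The curvature of `ι_∞` -/

section Curvature

variable {n : ℕ} {d : Fin n → ℤ} {v : Fin n → C.carrier}

theorem q₁_quad [CharZero K] (hv : IsHomogeneousTuple (C.shift 1) d v) (B : Finset (Fin n)) :
    A.q₁ (T.quad d v B) = -∑ S ∈ B.powerset, listSign K d S (B \ S) •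
      A.q₂ (A.q₁ (onSubset T.ιInfty v S)) (onSubset T.ιInfty v (B \ S)) := by
  have e : ∀ S ∈ B.powerset, A.q₁ (listSign K d S (B \ S) •
      A.q₂ (onSubset T.ιInfty v S) (onSubset T.ιInfty v (B \ S))) =
      -(listSign K d S (B \ S) •
        A.q₂ (A.q₁ (onSubset T.ιInfty v S)) (onSubset T.ιInfty v (B \ S))) -
      listSign K d (B \ S) S •
        A.q₂ (A.q₁ (onSubset T.ιInfty v (B \ S))) (onSubset T.ιInfty v S) := by
    intro S _
    have hS := T.onSubset_ιInfty_mem hv S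
    have hT := T.onSubset_ιInfty_mem hv (B \ S)
    rw [map_smul, A.q₁_q₂ hS _ hT, A.q₂_symm hS (A.q₁_mem hT),
      listSign_swap K d Finset.disjoint_sdiff, mul_add, mul_one, parSign_add]
    have h1 := parSign_mul_self K (∑ i ∈ S, d i)
    match_scalars
    · ring
    · linear_combination (-(listSign K d S (B \ S) *
        parSign K ((∑ i ∈ S, d i) * ∑ i ∈ B \ S, d i))) * h1
  rw [quad, map_smul, map_sum, Finset.sum_congr rfl e, Finset.sum_sub_distrib,
    ← Finset.sum_powerset_sdiff_comm B fun S T' => listSign K d S T' •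
        A.q₂ (A.q₁ (onSubset T.ιInfty v S)) (onSubset T.ιInfty v T'), Finset.sum_neg_distrib]
  module

/-- The quadratic expression applied to itself vanishes, by the Jacobi identity: its terms are
indexed by the splittings of `B` into three parts, and the three cyclic permutations of each
splitting cancel. -/
theorem sum_q₂_quad [CharZero K] (hv : IsHomogeneousTuple (C.shift 1) d v)
    (B : Finset (Fin n)) :
    ∑ S ∈ B.powerset, listSign K d S (B \ S) •
      A.q₂ (T.quad d v S) (onSubset T.ιInfty v (B \ S)) = 0 := by
  set F := onSubset T.ιInfty v with hF
  let t : Finset (Fin n) → Finset (Fin n) → Finset (Fin n) → A.carrier := fun S T' U =>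
    (listSign K d S T' * listSign K d S U * listSign K d T' U) • A.q₂ (A.q₂ (F S) (F T')) (F U)
  have e : ∑ S ∈ B.powerset, listSign K d S (B \ S) • A.q₂ (T.quad d v S) (F (B \ S)) =
      (2⁻¹ : K) • sumSplit₃ B t := by
    rw [sumSplit₃_eq, Finset.smul_sum]
    refine Finset.sum_congr rfl fun V _ => ?_
    simp only [quad, map_smul, map_sum, LinearMap.smul_apply, LinearMap.sum_apply]
    rw [smul_comm, Finset.smul_sum]
    congr 1
    refine Finset.sum_congr rfl fun S hS => ?_
    have h := listSign_union_left K d (S := S) (T := V \ S) Finset.disjoint_sdiff (B \ V)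
    rw [Finset.union_sdiff_of_subset (Finset.mem_powerset.1 hS)] at h
    rw [smul_smul, h]
    congr 1
    ring
  have h0 : sumSplit₃ B (fun S T' U => t S T' U + t S U T' + t T' U S) = 0 := by
    rw [sumSplit₃_congr B (g := fun _ _ _ => 0)]
    · simp [sumSplit₃]
    · intro S T' U h1 h2 h3
      have hS := T.onSubset_ιInfty_mem hv S
      have hT := T.onSubset_ιInfty_mem hv T'
      have hU := T.onSubset_ιInfty_mem hv U
      have hJ := A.q₂_jacobi hS hT hU
      simp only [t]
      rw [listSign_swap K d h1, listSign_swap K d h2, listSign_swap K d h3]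
      rw [mul_add, parSign_add] at hJ
      rw [← smul_zero (listSign K d S T' * listSign K d S U * listSign K d T' U), ← hJ]
      simp only [hF]
      module
  have h3 : sumSplit₃ B (fun S T' U => t S T' U + t S U T' + t T' U S) =
      (3 : K) • sumSplit₃ B t := by
    have hadd : ∀ f g : Finset (Fin n) → Finset (Fin n) → Finset (Fin n) → A.carrier,
        sumSplit₃ B (fun S T' U => f S T' U + g S T' U) = sumSplit₃ B f + sumSplit₃ B g := by
      intro f g
      simp only [sumSplit₃, Finset.sum_add_distrib]
    rw [hadd (fun S T' U => t S T' U + t S U T') fun S T' U => t T' U S,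
      hadd t fun S T' U => t S U T', sumSplit₃_swap_right,
      sumSplit₃_swap_left B fun S T' U => t S U T', sumSplit₃_swap_right]
    module
  rw [e]
  rw [h3] at h0
  rw [(smul_eq_zero.1 h0).resolve_left (by norm_num), smul_zero]

/-- The components of `R(ι_∞(x))`, where `R(y) = q₁(y) + ½ q₂(y, y)` is the curvature. -/
noncomputable def curvature (d : Fin n → ℤ) (v : Fin n → C.carrier) (B : Finset (Fin n)) :
    A.carrier :=
  A.q₁ (onSubset T.ιInfty v B) + T.quad d v B

/-- The Bianchi identity. -/
theorem q₁_quad_eq_curvature [CharZero K] (hv : IsHomogeneousTuple (C.shift 1) d v)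
    (B : Finset (Fin n)) :
    A.q₁ (T.quad d v B) = -∑ S ∈ B.powerset, listSign K d S (B \ S) •
      A.q₂ (T.curvature d v S) (onSubset T.ιInfty v (B \ S)) := by
  simp only [curvature, map_add, LinearMap.add_apply, smul_add, Finset.sum_add_distrib]
  rw [T.sum_q₂_quad hv, add_zero, T.q₁_quad hv]

/-- The homotopy relation turns the Bianchi identity into a recursion for the curvature. -/
theorem curvature_eq [CharZero K] (hv : IsHomogeneousTuple (C.shift 1) d v)
    (B : Finset (Fin n)) :
    T.curvature d v B = T.ι (onSubset T.bracket v B) +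
      T.h (∑ S ∈ B.powerset, listSign K d S (B \ S) •
        A.q₂ (T.curvature d v S) (onSubset T.ιInfty v (B \ S))) := by
  have h1 := T.homotopy (T.quad d v B)
  rw [T.q₁_quad_eq_curvature hv, map_neg, neg_add_eq_iff_eq_add] at h1
  rw [curvature, T.onSubset_ιInfty hv, T.onSubset_bracket hv, map_add, h1, map_add, map_neg,
    T.ι_d]
  change -(A.d _) + _ + _ = _
  abel

end Curvature

/-! ### The derivative of `ι_∞` along the transferred brackets -/

section Cons

variable {n : ℕ} {d : Fin n → ℤ} {v : Fin n → C.carrier} {e : ℤ} {x : C.carrier}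

theorem isHomogeneousTuple_cons (hv : IsHomogeneousTuple (C.shift 1) d v)
    (hx : x ∈ C.deg (1 + e)) :
    IsHomogeneousTuple (C.shift 1) (Fin.cons e d : Fin (n + 1) → ℤ) (Fin.cons x v) := by
  intro i
  induction i using Fin.cases with
  | zero => exact hx
  | succ i => exact hv i

theorem linTerm_cons (x : C.carrier) (v : Fin n → C.carrier) (B : Finset (Fin n)) :
    linTerm (Fin.cons x v : Fin (n + 1) → C.carrier)
      (insert 0 (B.map (Fin.succOrderEmb n).toEmbedding)) = if B = ∅ then x else 0 := by
  split_ifs with h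
  · rw [h, Finset.map_empty, insert_empty_eq, linTerm_singleton, Fin.cons_zero]
  · rw [linTerm_of_card_ne]
    rw [Finset.card_insert_of_notMem (by simp), Finset.card_map]
    simpa using h

theorem zero_notMem_map_succ (B : Finset (Fin n)) :
    (0 : Fin (n + 1)) ∉ B.map (Fin.succOrderEmb n).toEmbedding := by simp

/-- In the quadratic expression for the sequence `x, v₁, …, vₙ` the terms in which `x` belongs to
the first part and those in which it belongs to the second part have the same sum, which cancels
the factor `½`. -/
theorem quad_cons [CharZero K] (hv : IsHomogeneousTuple (C.shift 1) d v)
    (hx : x ∈ C.deg (1 + e)) (B : Finset (Fin n)) :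
    T.quad (Fin.cons e d : Fin (n + 1) → ℤ) (Fin.cons x v)
      (insert 0 (B.map (Fin.succOrderEmb n).toEmbedding)) =
    ∑ S ∈ B.powerset, listSign K d S (B \ S) •
      A.q₂ (T.ιInfty (S.card + 1) (Fin.cons x (subTuple v S))) (onSubset T.ιInfty v (B \ S)) := by
  have hc := isHomogeneousTuple_cons hv hx
  set d' : Fin (n + 1) → ℤ := Fin.cons e d with hd'
  set v' : Fin (n + 1) → C.carrier := Fin.cons x v with hv'
  set B' := B.map (Fin.succOrderEmb n).toEmbedding with hB'
  have h0 : (0 : Fin (n + 1)) ∉ B' := zero_notMem_map_succ B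
  set F := onSubset T.ιInfty v' with hF
  have e1 : ∀ S ∈ B'.powerset,
      listSign K d' S (insert 0 B' \ S) • A.q₂ (F S) (F (insert 0 B' \ S)) =
        listSign K d' (insert 0 (B' \ S)) S • A.q₂ (F (insert 0 (B' \ S))) (F S) := by
    intro S hS
    have hS' : (0 : Fin (n + 1)) ∉ S := fun h => h0 (Finset.mem_powerset.1 hS h)
    rw [Finset.insert_sdiff_of_notMem _ hS',
      listSign_swap K d' (S := S) (T := insert 0 (B' \ S)),
      A.q₂_symm (T.onSubset_ιInfty_mem hc S) (T.onSubset_ιInfty_mem hc _), smul_smul,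
      mul_comm (listSign K d' S _)]
    rw [Finset.disjoint_insert_right]
    exact ⟨hS', Finset.disjoint_sdiff⟩
  have e2 : ∀ S ∈ B'.powerset,
      listSign K d' (insert 0 S) (insert 0 B' \ insert 0 S) •
        A.q₂ (F (insert 0 S)) (F (insert 0 B' \ insert 0 S)) =
      listSign K d' (insert 0 S) (B' \ S) • A.q₂ (F (insert 0 S)) (F (B' \ S)) := by
    intro S hS
    rw [Finset.insert_sdiff_insert, Finset.sdiff_insert_of_notMem h0]
  rw [quad, Finset.sum_powerset_insert h0, Finset.sum_congr rfl e1, Finset.sum_congr rfl e2,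
    ← Finset.sum_powerset_sdiff_comm B' fun S T' =>
      listSign K d' (insert 0 S) T' • A.q₂ (F (insert 0 S)) (F T'),
    hB', Finset.sum_powerset_map, ← two_smul K, smul_smul, inv_mul_cancel₀ two_ne_zero, one_smul]
  refine Finset.sum_congr rfl fun S _ => ?_
  rw [← Finset.map_sdiff, hF, hv', onSubset_cons, onSubset_map_succ]
  congr 1
  rw [Finset.insert_eq, listSign_union_left _ _ (by simp), listSign_map]
  have : listSign K d' {0} ((B \ S).map (Fin.succOrderEmb n).toEmbedding) = 1 := by
    simp [listSign]
  rw [this, one_mul]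
  rfl

theorem ιInfty_cons [CharZero K] (hv : IsHomogeneousTuple (C.shift 1) d v)
    (hx : x ∈ C.deg (1 + e)) (B : Finset (Fin n)) :
    T.ιInfty (B.card + 1) (Fin.cons x (subTuple v B)) = (if B = ∅ then T.ι x else 0) +
      T.h (∑ S ∈ B.powerset, listSign K d S (B \ S) •
        A.q₂ (T.ιInfty (S.card + 1) (Fin.cons x (subTuple v S)))
          (onSubset T.ιInfty v (B \ S))) := by
  rw [← onSubset_cons, T.onSubset_ιInfty (isHomogeneousTuple_cons hv hx), linTerm_cons,
    T.quad_cons hv hx, apply_ite T.ι, map_zero]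

theorem bracket_cons [CharZero K] (hv : IsHomogeneousTuple (C.shift 1) d v)
    (hx : x ∈ C.deg (1 + e)) (B : Finset (Fin n)) :
    T.bracket (B.card + 1) (Fin.cons x (subTuple v B)) = -(if B = ∅ then C.d x else 0) +
      T.π (∑ S ∈ B.powerset, listSign K d S (B \ S) •
        A.q₂ (T.ιInfty (S.card + 1) (Fin.cons x (subTuple v S)))
          (onSubset T.ιInfty v (B \ S))) := by
  rw [← onSubset_cons, T.onSubset_bracket (isHomogeneousTuple_cons hv hx), linTerm_cons,
    T.quad_cons hv hx, apply_ite C.d, map_zero]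

/-- The components of the derivative of `ι_∞` along the vector field given by the transferred
brackets. -/
noncomputable def pushforward (d : Fin n → ℤ) (v : Fin n → C.carrier) (B : Finset (Fin n)) :
    A.carrier :=
  ∑ S ∈ B.powerset, listSign K d S (B \ S) •
    T.ιInfty ((B \ S).card + 1) (Fin.cons (onSubset T.bracket v S) (subTuple v (B \ S)))

/-- A sum over splittings of `B` into the argument `S` of the inner bracket, the remaining arguments
`T'` of the first factor and the arguments of the second factor, in two groupings. -/
theorem sum_sum_q₂_eq_pushforward (B : Finset (Fin n)) :
    ∑ S ∈ B.powerset, listSign K d S (B \ S) • ∑ T' ∈ (B \ S).powerset,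
      listSign K d T' ((B \ S) \ T') •
        A.q₂ (T.ιInfty (T'.card + 1) (Fin.cons (onSubset T.bracket v S) (subTuple v T')))
          (onSubset T.ιInfty v ((B \ S) \ T')) =
    ∑ V ∈ B.powerset, listSign K d V (B \ V) •
      A.q₂ (T.pushforward d v V) (onSubset T.ιInfty v (B \ V)) := by
  have h1 : ∀ S ∈ B.powerset, ∀ T' ∈ (B \ S).powerset,
      listSign K d S (B \ S) = listSign K d S T' * listSign K d S ((B \ S) \ T') := by
    intro S _ T' hT
    rw [← listSign_union_right K d Finset.disjoint_sdiff,
      Finset.union_sdiff_of_subset (Finset.mem_powerset.1 hT)]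
  have h2 : ∀ V ∈ B.powerset, ∀ S ∈ V.powerset,
      listSign K d V (B \ V) = listSign K d S (B \ V) * listSign K d (V \ S) (B \ V) := by
    intro V _ S hS
    rw [← listSign_union_left K d Finset.disjoint_sdiff,
      Finset.union_sdiff_of_subset (Finset.mem_powerset.1 hS)]
  have e := Finset.sum_powerset_sdiff_assoc B fun S T' U =>
    (listSign K d S T' * listSign K d S U * listSign K d T' U) •
      A.q₂ (T.ιInfty (T'.card + 1) (Fin.cons (onSubset T.bracket v S) (subTuple v T')))
          (onSubset T.ιInfty v U)
  calc _ = _ := ?_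
    _ = _ := e
    _ = _ := ?_
  · refine Finset.sum_congr rfl fun S hS => ?_
    rw [Finset.smul_sum]
    refine Finset.sum_congr rfl fun T' hT => ?_
    rw [smul_smul, h1 S hS T' hT]
  · refine Finset.sum_congr rfl fun V hV => ?_
    simp only [pushforward, map_sum, map_smul, LinearMap.sum_apply, LinearMap.smul_apply,
      Finset.smul_sum]
    refine Finset.sum_congr rfl fun S hS => ?_
    rw [smul_smul, h2 V hV S hS]
    congr 1
    ring

theorem sum_ite_sdiff_eq_empty {N : Type*} [AddCommGroup N] [Module K N] (B : Finset (Fin n))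
    (f : Finset (Fin n) → N) :
    ∑ S ∈ B.powerset, listSign K d S (B \ S) • (if B \ S = ∅ then f S else 0) = f B := by
  rw [Finset.sum_eq_single_of_mem B (by simp)]
  · simp
  · intro S hS hne
    rw [if_neg, smul_zero]
    intro h
    exact hne ((Finset.mem_powerset.1 hS).antisymm (Finset.sdiff_eq_empty_iff_subset.1 h))

theorem pushforward_eq [CharZero K] (hv : IsHomogeneousTuple (C.shift 1) d v)
    (B : Finset (Fin n)) :
    T.pushforward d v B = T.ι (onSubset T.bracket v B) +
      T.h (∑ S ∈ B.powerset, listSign K d S (B \ S) •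
        A.q₂ (T.pushforward d v S) (onSubset T.ιInfty v (B \ S))) := by
  rw [← T.sum_sum_q₂_eq_pushforward,
    ← sum_ite_sdiff_eq_empty (K := K) (d := d) B fun S => T.ι (onSubset T.bracket v S),
    map_sum, ← Finset.sum_add_distrib]
  refine Finset.sum_congr rfl fun S _ => ?_
  rw [T.ιInfty_cons hv (T.onSubset_bracket_mem hv S), smul_add, map_smul]

/-- `ι_∞` maps the vector field given by the transferred brackets to the one given by `q₁` and
`q₂`, since both sides satisfy the same recursion. -/
theorem pushforward_eq_curvature [CharZero K] (hv : IsHomogeneousTuple (C.shift 1) d v)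
    (B : Finset (Fin n)) : T.pushforward d v B = T.curvature d v B := by
  induction B using Finset.strongInduction with
  | H B ih =>
    rw [T.pushforward_eq hv, T.curvature_eq hv]
    congr 2
    refine Finset.sum_congr rfl fun S hS => ?_
    rcases (Finset.mem_powerset.1 hS).eq_or_ssubset with rfl | h
    · rw [Finset.sdiff_self, onSubset_empty _ T.ιInfty_zero, map_zero, map_zero]
    · rw [ih S h]

/-- The Jacobi identities of the transferred brackets. Replacing the derivative of `ι_∞` along the
brackets by the curvature, the quadratic terms become `-π q₁` of the quadratic expression, by the
Bianchi identity, and cancel against the differential of the bracket. -/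
theorem sum_bracket_bracket [CharZero K] (hv : IsHomogeneousTuple (C.shift 1) d v)
    (B : Finset (Fin n)) :
    ∑ S ∈ B.powerset, listSign K d S (B \ S) • T.bracket ((B \ S).card + 1)
      (Fin.cons (onSubset T.bracket v S) (subTuple v (B \ S))) = 0 := by
  have e : ∀ S ∈ B.powerset, listSign K d S (B \ S) • T.bracket ((B \ S).card + 1)
      (Fin.cons (onSubset T.bracket v S) (subTuple v (B \ S))) =
      -(listSign K d S (B \ S) • (if B \ S = ∅ then C.d (onSubset T.bracket v S) else 0)) +
      T.π (listSign K d S (B \ S) • ∑ T' ∈ (B \ S).powerset,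
        listSign K d T' ((B \ S) \ T') •
        A.q₂ (T.ιInfty (T'.card + 1) (Fin.cons (onSubset T.bracket v S) (subTuple v T')))
          (onSubset T.ιInfty v ((B \ S) \ T'))) := by
    intro S _
    rw [T.bracket_cons hv (T.onSubset_bracket_mem hv S), smul_add, smul_neg, map_smul]
  rw [Finset.sum_congr rfl e, Finset.sum_add_distrib, Finset.sum_neg_distrib,
    sum_ite_sdiff_eq_empty (K := K) (d := d) B fun S => C.d (onSubset T.bracket v S),
    ← map_sum, T.sum_sum_q₂_eq_pushforward]
  simp only [T.pushforward_eq_curvature hv]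
  have h := congrArg T.π (T.q₁_quad_eq_curvature hv B)
  rw [map_neg, eq_neg_iff_add_eq_zero] at h
  rw [T.onSubset_bracket hv, map_add, map_neg, C.d_d, neg_zero, zero_add, ← T.π_d, ← h,
    DGLA.q₁, LinearMap.neg_apply, map_neg]

end Cons

/-- The homotopy transfer theorem: the transferred brackets form an `L∞` structure. -/
theorem isLInfinity_bracket [CharZero K] : IsLInfinity C.toGradedSpace T.bracket where
  zero := rfl
  isSymHom := T.isSymHom_bracket
  jacobi n d v hv := by
    have h := T.sum_bracket_bracket hv Finset.univ
    rw [← h, Finset.powerset_univ]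
    refine (Finset.sum_subset (Finset.subset_univ _) ?_).trans
      (Finset.sum_congr rfl fun S _ => ?_)
    · intro S _ hS
      rw [Finset.mem_filter, not_and, Finset.not_nonempty_iff_eq_empty] at hS
      rw [MultilinearMap.map_coord_zero _ 0, smul_zero]
      rw [Fin.cons_zero, hS (Finset.mem_univ _)]
      exact onSubset_empty T.bracket rfl v
    · rw [koszulSign_unshuffle_smul K, ← Finset.compl_eq_univ_sdiff]
      rfl

end TransferData

/-! ### Maps induced in cohomology -/

namespace Cohomology

variable {K : Type v} [Field K] {V : Type u} [AddCommGroup V] [Module K V] {W : Type w}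
  [AddCommGroup W] [Module K W] {d : V →ₗ[K] V} {d' : W →ₗ[K] W} {f : V →ₗ[K] W}
  {hf : ∀ x, f (d x) = d' (f x)}

theorem map_injective_iff : Function.Injective (map f hf) ↔
    ∀ x, d x = 0 → f x ∈ LinearMap.range d' → x ∈ LinearMap.range d := by
  rw [injective_iff_map_eq_zero]
  constructor
  · intro h x hx hfx
    exact (Submodule.Quotient.mk_eq_zero ((LinearMap.range d).submoduleOf (LinearMap.ker d))
      (x := ⟨x, hx⟩)).1 (h (Submodule.Quotient.mk ⟨x, hx⟩)
        ((Submodule.Quotient.mk_eq_zero _).2 hfx))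
  · intro h y hy
    obtain ⟨⟨x, hx⟩, rfl⟩ := Submodule.Quotient.mk_surjective _ y
    exact (Submodule.Quotient.mk_eq_zero _).2 (h x hx ((Submodule.Quotient.mk_eq_zero
      ((LinearMap.range d').submoduleOf (LinearMap.ker d'))).1 hy))

theorem map_surjective (h : ∀ y, d' y = 0 → ∃ x, d x = 0 ∧ f x - y ∈ LinearMap.range d') :
    Function.Surjective (map f hf) := by
  intro y
  obtain ⟨⟨y, hy⟩, rfl⟩ := Submodule.Quotient.mk_surjective _ y
  obtain ⟨x, hx, hxy⟩ := h y hy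
  exact ⟨Submodule.Quotient.mk ⟨x, hx⟩, (Submodule.Quotient.eq _).2 hxy⟩

end Cohomology

/-! ### Strict morphisms from abelian `L∞`-algebras without differential -/

namespace LInfinityAlgebra

variable {K : Type v} [Field K]

/-- The `L∞`-algebra on `V` all of whose brackets, including the differential, vanish. -/
abbrev ofZero (V : GradedSpace.{u} K) : LInfinityAlgebra.{u} K where
  space := V
  q _ := 0
  isLInfinity :=
    { zero := rfl
      isSymHom := fun _ =>
        { map_mem := fun _ _ _ => zero_mem _
          symm := fun _ _ _ _ => (smul_zero _).symm }
      jacobi := fun _ _ _ _ => Finset.sum_eq_zero fun _ _ => smul_zero _ }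

/-- The sequence of multilinear maps whose linear term is `j` and whose other terms vanish. -/
noncomputable def strictMap {V W : GradedSpace.{u} K} (j : V →ₗ[K] W) :
    ∀ n : ℕ, MultilinearMap K (fun _ : Fin n => V.carrier) W.carrier
  | 1 => MultilinearMap.ofSubsingleton K V.carrier W.carrier (0 : Fin 1) j
  | _ => 0

theorem strictMap_mem_range {V W : GradedSpace.{u} K} (j : V →ₗ[K] W) (n : ℕ)
    (v : Fin n → V) : strictMap j n v ∈ LinearMap.range j := by
  rcases n with _ | _ | n
  · exact zero_mem _
  · exact ⟨v 0, rfl⟩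
  · exact zero_mem _

theorem isSymHom_strictMap {V W : GradedSpace.{u} K} (j : V →ₗ[K] W)
    (hj : ∀ i, ∀ x ∈ V.deg i, j x ∈ W.deg i) (n : ℕ) :
    IsSymHom (V.shift 1) (W.shift 1) 0 (strictMap j n) := by
  rcases n with _ | _ | n
  · exact ⟨fun _ _ _ => zero_mem _, fun _ _ _ _ => (smul_zero _).symm⟩
  · refine ⟨fun d v hv => ?_, fun d v hv σ => ?_⟩
    · have := hj _ _ (hv 0)
      rw [add_zero, Fin.sum_univ_one]
      exact this
    · have hσ : σ = 1 := Equiv.ext fun i => Subsingleton.elim (α := Fin 1) _ _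
      rw [koszulSign_perm_smul K, hσ]
      simp [permSign]
  · exact ⟨fun _ _ _ => zero_mem _, fun _ _ _ _ => (smul_zero _).symm⟩

/-- A linear map from a graded vector space to an `L∞`-algebra all of whose brackets vanish on the
image is an `L∞`-morphism. -/
noncomputable def strictMorphism (V : GradedSpace.{u} K) (W : LInfinityAlgebra.{u} K)
    (j : V →ₗ[K] W.space) (hj : ∀ i, ∀ x ∈ V.deg i, j x ∈ W.space.deg i)
    (hq : ∀ (n : ℕ) (deg : Fin n → ℤ) (w : Fin n → W.space),
      IsHomogeneousTuple (W.space.shift 1) deg w → (∀ k, w k ∈ LinearMap.range j) →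
      W.q n w = 0) :
    Morphism (ofZero V) W where
  f := strictMap j
  zero := rfl
  isSymHom := isSymHom_strictMap j hj
  comm n deg v hv := by
    rw [Finset.sum_eq_zero, Finset.sum_eq_zero]
    · intro r _
      rw [Finset.sum_eq_zero, smul_zero]
      intro c _
      have h := hq r (fun k => (∑ i, deg (Finset.orderEmbOfFin {i | c i = k} rfl i)) + 0)
        (fun k => strictMap j (Finset.card {i | c i = k}) (subTuple v {i | c i = k}))
        (fun k => (isSymHom_strictMap j hj _).map_mem _ _ fun i => hv _)
        (fun k => strictMap_mem_range j _ _)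
      exact (congrArg _ h).trans (smul_zero _)
    · intro S _
      rw [MultilinearMap.map_coord_zero _ 0, smul_zero]
      rfl

end LInfinityAlgebra

/-! ### Vanishing of the brackets of a mapping cone on `M[-1]` -/

namespace TransferData

variable {K : Type v} [Field K] {A : DGLA.{w} K} {C : DGSpace.{u} K} (T : TransferData A C)

theorem linTerm_eq_zero_or {n : ℕ} (v : Fin n → C.carrier) (B : Finset (Fin n)) :
    linTerm v B = 0 ∨ ∃ i, linTerm v B = v i := by
  by_cases h : B.card = 1
  · obtain ⟨i, rfl⟩ := Finset.card_eq_one.1 h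
    exact .inr ⟨i, linTerm_singleton v i⟩
  · exact .inl (linTerm_of_card_ne v h)

/-- If `q₂` vanishes on the `ι(vᵢ)`, then so do all quadratic expressions in them. -/
theorem quad_eq_zero {n : ℕ} {d : Fin n → ℤ} {v : Fin n → C.carrier}
    (hv : IsHomogeneousTuple (C.shift 1) d v)
    (h : ∀ i j, A.q₂ (T.ι (v i)) (T.ι (v j)) = 0) (B : Finset (Fin n)) : T.quad d v B = 0 := by
  induction B using Finset.strongInduction with
  | H B ih =>
    rw [quad, Finset.sum_eq_zero, smul_zero]
    intro S hS
    rw [Finset.mem_powerset] at hS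
    rcases S.eq_empty_or_nonempty with rfl | hne
    · rw [onSubset_empty _ T.ιInfty_zero, map_zero, LinearMap.zero_apply, smul_zero]
    rcases hS.eq_or_ssubset with rfl | hss
    · rw [Finset.sdiff_self, onSubset_empty _ T.ιInfty_zero, map_zero, smul_zero]
    · rw [T.onSubset_ιInfty hv, T.onSubset_ιInfty hv, ih S hss,
        ih _ (Finset.sdiff_ssubset hS hne), map_zero, add_zero, add_zero]
      rcases linTerm_eq_zero_or v S with h1 | ⟨i, h1⟩
      · rw [h1, map_zero, map_zero, LinearMap.zero_apply, smul_zero]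
      rcases linTerm_eq_zero_or v (B \ S) with h2 | ⟨j, h2⟩
      · rw [h2, map_zero, map_zero, smul_zero]
      · rw [h1, h2, h, smul_zero]

theorem bracket_eq_zero {n : ℕ} {d : Fin n → ℤ} {v : Fin n → C.carrier}
    (hv : IsHomogeneousTuple (C.shift 1) d v) (hd : ∀ i, C.d (v i) = 0)
    (h : ∀ i j, A.q₂ (T.ι (v i)) (T.ι (v j)) = 0) : T.bracket n v = 0 := by
  rw [T.bracket_apply hv, T.quad_eq_zero hv h, map_zero, add_zero, neg_eq_zero]
  rcases linTerm_eq_zero_or v Finset.univ with h1 | ⟨i, h1⟩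
  · rw [h1, map_zero]
  · rw [h1, hd]

end TransferData

namespace DGLAHom

variable {K : Type v} [Field K] {L M : DGLA.{u} K} (χ : DGLAHom L M)

/-- The inclusion `m ↦ (0, m)` of `M[-1]` in the cone. -/
def coneInr : M.carrier →ₗ[K] χ.cone.carrier := LinearMap.inr K L.carrier M.carrier

theorem cone_d_coneInr (m : M.carrier) : χ.cone.d (χ.coneInr m) = -χ.coneInr (M.d m) := by
  refine Prod.ext ?_ ?_
  · change L.d 0 = -0
    rw [map_zero, neg_zero]
  · change χ.toLinearMap 0 - M.d m = -M.d m
    rw [map_zero, zero_sub]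

/-- The forms `dt m` and `dt m'` have bracket `0`, since `dt dt = 0`. -/
theorem thomWhitney_br_whitneyE_coneInr (m m' : M.carrier) :
    χ.thomWhitney.br (χ.whitneyE (χ.coneInr m)) (χ.whitneyE (χ.coneInr m')) = 0 := by
  have hP : M.mono Polynomial.X (χ.toLinearMap 0) = 0 := by rw [map_zero, map_zero]
  refine Subtype.ext (Prod.ext ?_ (Prod.ext ?_ ?_))
  · exact (map_zero _)
  · change GradedSpace.polyBilin M.br (M.mono Polynomial.X (χ.toLinearMap 0)) _ = 0
    rw [hP, map_zero, LinearMap.zero_apply]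
  · change GradedSpace.polyBilin M.br (M.mono 1 m) (M.mono Polynomial.X (χ.toLinearMap 0)) +
      GradedSpace.polyBilin M.br
        (GradedSpace.polyMap M.sgn (M.mono Polynomial.X (χ.toLinearMap 0))) _ = 0
    rw [hP, map_zero, map_zero, map_zero, LinearMap.zero_apply, add_zero]

theorem coneBracket_coneInr_eq_zero [CharZero K] {n : ℕ} {d : Fin n → ℤ}
    {v : Fin n → χ.cone.carrier}
    (hv : IsHomogeneousTuple (χ.cone.shift 1) d v)
    (h : ∀ i, ∃ m, M.d m = 0 ∧ v i = χ.coneInr m) :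
    χ.coneBracket n v = 0 := by
  refine χ.transferData.bracket_eq_zero hv (fun i => ?_) fun i j => ?_
  · obtain ⟨m, hm, e⟩ := h i
    rw [e, cone_d_coneInr, hm, map_zero, neg_zero]
  · have hi := χ.transferData.ι_mem _ _ (hv i)
    obtain ⟨m, -, e⟩ := h i
    obtain ⟨m', -, e'⟩ := h j
    rw [DGLA.q₂_eq _ hi, e, e', neg_eq_zero]
    exact (congrArg _ (χ.thomWhitney_br_whitneyE_coneInr m m')).trans (smul_zero _)

end DGLAHom

/-! ### A graded space of representatives for the cohomology of the cone -/

/-- The direct sum of a family of subspaces, graded by the index. -/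
noncomputable abbrev GradedSpace.directSum {K : Type v} [Field K] {V : Type u} [AddCommGroup V]
    [Module K V] (H : ℤ → Submodule K V) : GradedSpace.{u} K where
  carrier := DirectSum ℤ fun i => H i
  deg i := LinearMap.range (DirectSum.lof K ℤ (fun i => H i) i)
  internal := by
    refine isInternal_of_proj _
      (fun i => DirectSum.lof K ℤ (fun i => H i) i ∘ₗ DirectSum.component K ℤ (fun i => H i) i)
      (fun i x => ⟨_, rfl⟩) ?_ ?_ ?_
    · rintro i _ ⟨x, rfl⟩
      simp
    · rintro i j h _ ⟨x, rfl⟩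
      rw [LinearMap.comp_apply, DirectSum.component.of, dif_neg h, map_zero]
    · intro x
      classical
      exact ⟨DFinsupp.support x, DirectSum.sum_support_of x⟩

/-- A complement of `Z ⊓ N` in `Z`. -/
theorem Submodule.exists_complement_in {K : Type v} [Field K] {V : Type u} [AddCommGroup V]
    [Module K V] (Z N : Submodule K V) :
    ∃ H : Submodule K V, H ≤ Z ∧ H ⊓ N = ⊥ ∧ ∀ z ∈ Z, ∃ x ∈ H, x - z ∈ N := by
  obtain ⟨Q, hQ⟩ := Submodule.exists_isCompl (N.submoduleOf Z)
  refine ⟨Q.map Z.subtype, Submodule.map_subtype_le _ _, ?_, ?_⟩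
  · rw [eq_bot_iff]
    rintro _ ⟨⟨x, hx, rfl⟩, hN⟩
    have : x ∈ N.submoduleOf Z ⊓ Q := ⟨hN, hx⟩
    rw [hQ.inf_eq_bot, Submodule.mem_bot] at this
    rw [this]; exact zero_mem _
  · intro z hz
    obtain ⟨a, ha, b, hb, hab⟩ := Submodule.mem_sup.1
      (hQ.sup_eq_top.symm ▸ Submodule.mem_top : (⟨z, hz⟩ : Z) ∈ N.submoduleOf Z ⊔ Q)
    refine ⟨b, ⟨b, hb, rfl⟩, ?_⟩
    have e : (b : V) - z = -(a : V) := by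
      have := congrArg Subtype.val hab
      rw [← show (a : V) + b = z from this]; abel
    rw [e]
    exact neg_mem ha

namespace DGLAHom

variable {K : Type v} [Field K] {L M : DGLA.{u} K} (χ : DGLAHom L M)

/-- The subspace `χ(Z(L)) + dM` of the elements `m` of `M` such that `(0, m)` is a coboundary of
the cone. -/
def coneBoundaries : Submodule K M.carrier :=
  (LinearMap.ker L.d).map χ.toLinearMap ⊔ LinearMap.range M.d

theorem proj_d (i : ℤ) (x : M.carrier) : M.proj (i + 1) (M.d x) = M.d (M.proj i x) := by
  refine M.induction (p := fun x => M.proj (i + 1) (M.d x) = M.d (M.proj i x)) x ?_ ?_ ?_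
  · intro j y hy
    by_cases h : j = i
    · subst h; rw [M.proj_of_mem hy, M.proj_of_mem (M.d_mem _ y hy)]
    · rw [M.proj_of_mem_ne hy h, M.proj_of_mem_ne (M.d_mem _ y hy) (by simpa using h), map_zero]
  · simp
  · intro y z hy hz; simp only [map_add, hy, hz]

theorem proj_mem_coneBoundaries (i : ℤ) {x : M.carrier} (hx : x ∈ χ.coneBoundaries) :
    M.proj i x ∈ χ.coneBoundaries := by
  obtain ⟨_, ⟨l, hl, rfl⟩, _, ⟨m, rfl⟩, rfl⟩ := Submodule.mem_sup.1 hx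
  rw [map_add, ← χ.map_proj]
  refine Submodule.add_mem_sup ⟨_, ?_, rfl⟩ ⟨M.proj (i - 1) m, ?_⟩
  · have := proj_d (M := L) i l
    rw [LinearMap.mem_ker.1 hl, map_zero] at this
    exact this.symm
  · rw [← proj_d, sub_add_cancel]

theorem coneInr_mem_range_d_iff {m : M.carrier} :
    χ.coneInr m ∈ LinearMap.range χ.cone.d ↔ m ∈ χ.coneBoundaries := by
  constructor
  · rintro ⟨⟨l, m'⟩, h⟩
    have h1 : L.d l = 0 := congrArg Prod.fst h
    have h2 : χ.toLinearMap l - M.d m' = m := congrArg Prod.snd h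
    rw [← h2, sub_eq_add_neg]
    exact Submodule.add_mem_sup ⟨l, h1, rfl⟩ (neg_mem ⟨m', rfl⟩)
  · intro h
    obtain ⟨_, ⟨l, hl, rfl⟩, _, ⟨m', rfl⟩, rfl⟩ := Submodule.mem_sup.1 h
    refine ⟨(l, -m'), Prod.ext hl ?_⟩
    change χ.toLinearMap l - M.d (-m') = _
    rw [map_neg, sub_neg_eq_add]
    rfl

/-- If `χ` is injective in cohomology, then every cocycle of the cone is cohomologous to one of
the form `(0, m)`. -/
theorem exists_coneInr_sub_mem_range_d
    (hcoh : Function.Injective (Cohomology.map χ.toLinearMap χ.map_d)) {y : χ.cone.carrier}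
    (hy : χ.cone.d y = 0) : ∃ m : M.carrier, M.d m = 0 ∧
      χ.coneInr m - y ∈ LinearMap.range χ.cone.d := by
  obtain ⟨l, m⟩ := y
  have h1 : L.d l = 0 := congrArg Prod.fst hy
  have h2 : χ.toLinearMap l - M.d m = 0 := congrArg Prod.snd hy
  obtain ⟨l', rfl⟩ := Cohomology.map_injective_iff.1 hcoh l h1 ⟨m, (sub_eq_zero.1 h2).symm⟩
  refine ⟨m - χ.toLinearMap l', ?_, (-l', 0), Prod.ext ?_ ?_⟩
  · rw [map_sub, ← χ.map_d, ← neg_sub, h2, neg_zero]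
  · change L.d (-l') = 0 - L.d l'
    rw [map_neg, zero_sub]
  · change χ.toLinearMap (-l') - M.d 0 = m - χ.toLinearMap l' - m
    rw [map_neg, map_zero]
    abel

/-- Subspaces `Hⁱ` of cocycles of `M[-1]` which map isomorphically onto the image of the
cohomology of `M[-1]` in that of the cone. -/
theorem exists_representatives : ∃ H : ℤ → Submodule K M.carrier,
    (∀ i, H i ≤ M.deg (-1 + i) ⊓ LinearMap.ker M.d) ∧ (∀ i, H i ⊓ χ.coneBoundaries = ⊥) ∧
    ∀ i, ∀ z ∈ M.deg (-1 + i) ⊓ LinearMap.ker M.d, ∃ x ∈ H i, x - z ∈ χ.coneBoundaries := by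
  choose H h1 h2 h3 using fun i : ℤ =>
    Submodule.exists_complement_in (M.deg (-1 + i) ⊓ LinearMap.ker M.d) χ.coneBoundaries
  exact ⟨H, h1, h2, h3⟩

section Representatives

variable {χ} {H : ℤ → Submodule K M.carrier}

/-- The sum map `⨁ᵢ Hⁱ → M`. -/
noncomputable def sumMap (H : ℤ → Submodule K M.carrier) :
    GradedSpace.directSum H →ₗ[K] M.carrier :=
  DirectSum.toModule K ℤ M.carrier fun i => (H i).subtype

theorem sumMap_lof (i : ℤ) (x : H i) :
    sumMap H (DirectSum.lof K ℤ (fun i => H i) i x) = x := by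
  exact DirectSum.toModule_lof K (φ := fun i => (H i).subtype) i x

theorem d_sumMap (hH : ∀ i, H i ≤ M.deg (-1 + i) ⊓ LinearMap.ker M.d)
    (x : GradedSpace.directSum H) : M.d (sumMap H x) = 0 := by
  refine (GradedSpace.directSum H).induction (p := fun x => M.d (sumMap H x) = 0) x ?_ ?_ ?_
  · rintro i _ ⟨y, rfl⟩
    rw [sumMap_lof]; exact (hH i y.2).2
  · simp
  · intro y z hy hz; rw [map_add, map_add, hy, hz, add_zero]

theorem proj_sumMap (hH : ∀ i, H i ≤ M.deg (-1 + i) ⊓ LinearMap.ker M.d) (i : ℤ)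
    (x : GradedSpace.directSum H) :
    M.proj (-1 + i) (sumMap H x) = DirectSum.component K ℤ (fun i => H i) i x := by
  refine (GradedSpace.directSum H).induction (p := fun x => M.proj (-1 + i) (sumMap H x) =
    DirectSum.component K ℤ (fun i => H i) i x) x ?_ ?_ ?_
  · rintro j _ ⟨y, rfl⟩
    rw [sumMap_lof, DirectSum.component.of]
    split_ifs with h
    · subst h; exact M.proj_of_mem (hH j y.2).1
    · exact M.proj_of_mem_ne (hH j y.2).1 (by simpa using h)
  · rw [map_zero, map_zero, map_zero]; rfl
  · intro y z hy hz
    rw [map_add, map_add, hy, hz, map_add]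
    rfl

theorem eq_zero_of_sumMap_mem (hH : ∀ i, H i ≤ M.deg (-1 + i) ⊓ LinearMap.ker M.d)
    (hN : ∀ i, H i ⊓ χ.coneBoundaries = ⊥) {x : GradedSpace.directSum H}
    (hx : sumMap H x ∈ χ.coneBoundaries) : x = 0 := by
  refine DFinsupp.ext fun i => Subtype.ext ?_
  have h : ((DirectSum.component K ℤ (fun i => H i) i x : H i) : M.carrier) ∈
      H i ⊓ χ.coneBoundaries :=
    ⟨Subtype.property _, proj_sumMap hH i x ▸ χ.proj_mem_coneBoundaries _ hx⟩
  rw [hN, Submodule.mem_bot] at h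
  exact h

theorem exists_sumMap_sub_mem
    (hZ : ∀ i, ∀ z ∈ M.deg (-1 + i) ⊓ LinearMap.ker M.d, ∃ x ∈ H i, x - z ∈ χ.coneBoundaries)
    {m : M.carrier} (hm : M.d m = 0) : ∃ x, sumMap H x - m ∈ χ.coneBoundaries := by
  have h : ∀ i, ∃ x ∈ H i, x - M.proj (-1 + i) m ∈ χ.coneBoundaries := by
    intro i
    refine hZ i _ ⟨M.proj_mem _ _, ?_⟩
    change M.d _ = 0
    rw [← proj_d, hm, map_zero]
  choose x hx hx' using h
  obtain ⟨S, hS⟩ := M.exists_sum_proj_shift (-1) m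
  refine ⟨∑ i ∈ S, DirectSum.lof K ℤ (fun i => H i) i ⟨x i, hx i⟩, ?_⟩
  have e : sumMap H (∑ i ∈ S, DirectSum.lof K ℤ (fun i => H i) i ⟨x i, hx i⟩) - m =
      ∑ i ∈ S, (x i - M.proj (-1 + i) m) := by
    have h := hS S subset_rfl
    rw [Finset.sum_sub_distrib, h, map_sum]
    exact congrArg (· - m) (Finset.sum_congr rfl fun i _ => sumMap_lof i ⟨x i, hx i⟩)
  rw [e]
  exact Submodule.sum_mem _ fun i _ => hx' i

end Representatives

/-- The abelian `L∞`-algebra `⨁ᵢ Hⁱ` of representatives is quasi-isomorphic to the cone by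
`x ↦ (0, x)`. -/
theorem isQuasiAbelian_cone [CharZero K]
    (hcoh : Function.Injective (Cohomology.map χ.toLinearMap χ.map_d))
    (h : IsLInfinity χ.cone.toGradedSpace χ.coneBracket) :
    LInfinityAlgebra.IsQuasiAbelian ⟨χ.cone.toGradedSpace, χ.coneBracket, h⟩ := by
  obtain ⟨H, hH, hN, hZ⟩ := χ.exists_representatives
  let W : LInfinityAlgebra K := ⟨χ.cone.toGradedSpace, χ.coneBracket, h⟩
  let j : GradedSpace.directSum H →ₗ[K] χ.cone.carrier := χ.coneInr ∘ₗ sumMap H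
  have hj : ∀ i, ∀ x ∈ (GradedSpace.directSum H).deg i, j x ∈ χ.cone.deg i := by
    rintro i _ ⟨y, rfl⟩
    refine ⟨zero_mem _, ?_⟩
    change sumMap H (DirectSum.lof K ℤ (fun i => H i) i y) ∈ M.deg (-1 + i)
    rw [sumMap_lof]; exact (hH i y.2).1
  let F := LInfinityAlgebra.strictMorphism (GradedSpace.directSum H) W j hj fun n d w hw hr =>
    χ.coneBracket_coneInr_eq_zero hw fun i => by
      obtain ⟨x, hx⟩ := hr i
      exact ⟨sumMap H x, d_sumMap hH x, hx.symm⟩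
  have hrange : ∀ y : χ.cone.carrier,
      y ∈ LinearMap.range W.differential ↔ y ∈ LinearMap.range χ.cone.d := by
    intro y
    constructor
    · rintro ⟨x, rfl⟩; exact ⟨-x, map_neg _ _⟩
    · rintro ⟨x, rfl⟩
      refine ⟨-x, ?_⟩
      change -χ.cone.d (-x) = _
      rw [map_neg, neg_neg]
  refine ⟨LInfinityAlgebra.ofZero (GradedSpace.directSum H), fun _ _ => rfl,
    .symm _ _ (.rel _ _ ⟨F, fun x => ?_, ?_, ?_⟩)⟩
  · change χ.coneInr (sumMap H 0) = -χ.cone.d (χ.coneInr (sumMap H x))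
    rw [cone_d_coneInr, d_sumMap hH, map_zero, map_zero, neg_zero, neg_zero]
  · refine Cohomology.map_injective_iff.2 fun x _ hx => ?_
    have hx' := eq_zero_of_sumMap_mem hH hN
      (χ.coneInr_mem_range_d_iff.1 ((hrange (χ.coneInr (sumMap H x))).1 hx))
    rw [hx']
    exact zero_mem _
  · refine Cohomology.map_surjective fun y hy => ?_
    obtain ⟨m, hm, hmy⟩ := χ.exists_coneInr_sub_mem_range_d hcoh
      (y := y) (neg_eq_zero.1 (show -χ.cone.d y = 0 from hy))
    obtain ⟨x, hx⟩ := exists_sumMap_sub_mem hZ hm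
    refine ⟨x, rfl, (hrange (χ.coneInr (sumMap H x) - y)).2 ?_⟩
    have := add_mem (χ.coneInr_mem_range_d_iff.2 hx) hmy
    rwa [map_sub, sub_add_sub_cancel] at this

end DGLAHom

theorem proposition3p4 {K : Type v} [Field K] [CharZero K] {L M : DGLA.{u} K} (χ : DGLAHom L M)
    (hinj : Function.Injective χ.toLinearMap)
    (hcoh : Function.Injective (Cohomology.map χ.toLinearMap χ.map_d)) :
    ∃ h : IsLInfinity χ.cone.toGradedSpace χ.coneBracket,
      LInfinityAlgebra.IsQuasiAbelian ⟨χ.cone.toGradedSpace, χ.coneBracket, h⟩ :=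
  ⟨χ.transferData.isLInfinity_bracket, χ.isQuasiAbelian_cone hcoh _⟩
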